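/- Let $M$ be a compact complex manifold with a smooth Hermitian metric $G$ and let $E$ be a holomorphic vector bundle of rank $r\ge 1$ on $M$. For a smooth Hermitian metric $H$ on $E$, with matrix $h_{\alpha\bar\beta}=H(e_\alpha,e_\beta)$ in a local holomorphic frame $(e_\alpha)$ and local holomorphic coordinates $(z_j)$, put $$R_{j\bar k\alpha\bar\beta}=-\frac{\partial^2 h_{\alpha\bar\beta}}{\partial z_j\partial\bar z_k}+\sum_{\gamma,\delta}h^{\gamma\bar\delta}\frac{\partial h_{\alpha\bar\delta}}{\partial z_j}\frac{\partial h_{\gamma\bar\beta}}{\partial\bar z_k},\qquad \Theta_H(u\otimes v,u\otimes v)=\sum_{j,k,\alpha,\beta}R_{j\bar k\alpha\bar\beta}\,u^j\bar u^k v^\alpha\bar v^\beta$$ for $u=\sum_j u^j\,\partial/\partial z_j\in T_M$ and $v=\sum_\alpha v^\alpha e_\alpha\in E$. Assume that $E$ is Griffiths nef: for every $\varepsilon>0$ there is a smooth Hermitian metric $H_\varepsilon$ on $E$ such that $$\Theta_{H_\varepsilon}(u\otimes v,u\otimes v)\ \ge\ -\varepsilon\,\|u\|_G^2\,\|v\|_{H_\varepsilon}^2\qquad\text{for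 all }x\in M,\ u\in T_{M,x},\ v\in E_x .$$ Then $E$ is nef in the sense of Demailly, Peternell and Schneider. That is, let $\mathbb P(E^*)$ be the compact complex manifold of lines in the fibres of the dual bundle $E^*$, and let $\mathscr O_{\mathbb P(E^*)}(1)$ be the holomorphic line bundle on it whose fibre at a line is the dual of that line. Then $\mathscr O_{\mathbb P(E^*)}(1)$ is nef: for every smooth Hermitian metric $g$ on $\mathbb P(E^*)$ and every $\varepsilon>0$ there is a smooth Hermitian metric $h$ on $\mathscr O_{\mathbb P(E^*)}(1)$ whose Chern curvature form satisfies $i\Theta_h\ge-\varepsilon g$; here $i\Theta_h=-i\,\partial\bar\partial\log\|s\|_h^2$ for a local nonvanishing holomorphic section $s$, and the inequality means $-\sum_{j,k}\frac{\partial^2\log\|s\|_h^2}{\partial\zeta_j\partial\bar\zeta_k}\xi^j\bar\xi^k\ge-\varepsilon\|\xi\|_g^2$ for all holomorphic tangent vectors $\xi=\sum_j\xi^j\,\partial/\partial\zeta_j$, where $(\zeta_j)$ are local holomorphic coordinates on $\mathbb P(E^*)$. -/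

import Mathlib

open Bundle Set
open scoped Manifold ContDiff Topology ComplexConjugate

set_option linter.unusedSectionVars false

noncomputable section

/-! ### Smooth Hermitian metrics on holomorphic vector bundles -/

/-- A smooth Hermitian metric on a complex vector bundle `V` (with model fibre `F`) over a complex
manifold `B` modelled on `EB`: a family of positive definite Hermitian forms on the fibres (linear
in the first and conjugate linear in the second variable) whose coefficients in the local
trivializations are `C^∞` functions on the real manifold underlying `B`. -/
structure SmoothHermitianMetric (EB : Type*) [NormedAddCommGroup EB] [NormedSpace ℂ EB]
    (F : Type*) [NormedAddCommGroup F] [NormedSpace ℂ F]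
    {B : Type*} [TopologicalSpace B] [ChartedSpace EB B]
    (V : B → Type*) [∀ x, AddCommGroup (V x)] [∀ x, Module ℂ (V x)]
    [TopologicalSpace (TotalSpace F V)] [∀ x, TopologicalSpace (V x)] [FiberBundle F V] where
  form : ∀ x, V x →ₗ[ℂ] V x →ₗ⋆[ℂ] ℂ
  conj_form : ∀ (x : B) (v w : V x), conj (form x v w) = form x w v
  form_pos : ∀ (x : B) (v : V x), v ≠ 0 → 0 < (form x v v).re
  smooth : ∀ (x₀ : B) (v w : F),
    ContMDiffOn 𝓘(ℝ, EB) 𝓘(ℝ, ℂ) ∞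
      (fun x => form x ((trivializationAt F V x₀).symm x v) ((trivializationAt F V x₀).symm x w))
      (trivializationAt F V x₀).baseSet

/-- The squared norm `‖v‖²` of a vector for a Hermitian metric. -/
def SmoothHermitianMetric.normSq {EB : Type*} [NormedAddCommGroup EB] [NormedSpace ℂ EB]
    {F : Type*} [NormedAddCommGroup F] [NormedSpace ℂ F]
    {B : Type*} [TopologicalSpace B] [ChartedSpace EB B]
    {V : B → Type*} [∀ x, AddCommGroup (V x)] [∀ x, Module ℂ (V x)]
    [TopologicalSpace (TotalSpace F V)] [∀ x, TopologicalSpace (V x)] [FiberBundle F V]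
    (H : SmoothHermitianMetric EB F V) (x : B) (v : V x) : ℝ :=
  (H.form x v v).re

/-- A Hermitian metric on a complex manifold `B`: a smooth Hermitian metric on its holomorphic
tangent bundle. -/
abbrev HermitianMetricOn (EB : Type*) [NormedAddCommGroup EB] [NormedSpace ℂ EB]
    (B : Type*) [TopologicalSpace B] [ChartedSpace EB B] [IsManifold 𝓘(ℂ, EB) ω B] :=
  SmoothHermitianMetric EB EB (TangentSpace 𝓘(ℂ, EB) : B → Type _)

/-! ### Wirtinger derivatives -/

/-- `∑ⱼ uʲ ∂f/∂zⱼ`, the derivative of `f` along the `(1,0)`-vector `∑ⱼ uʲ ∂/∂zⱼ`. -/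
def wirtinger {EB : Type*} [NormedAddCommGroup EB] [NormedSpace ℂ EB]
    (u : EB) (f : EB → ℂ) (z : EB) : ℂ :=
  (1 / 2 : ℂ) * (fderiv ℝ f z u - Complex.I * fderiv ℝ f z (Complex.I • u))

/-- `∑ⱼ ūʲ ∂f/∂z̄ⱼ`, the derivative of `f` along the `(0,1)`-vector `∑ⱼ ūʲ ∂/∂z̄ⱼ`. -/
def wirtingerBar {EB : Type*} [NormedAddCommGroup EB] [NormedSpace ℂ EB]
    (u : EB) (f : EB → ℂ) (z : EB) : ℂ :=
  (1 / 2 : ℂ) * (fderiv ℝ f z u + Complex.I * fderiv ℝ f z (Complex.I • u))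

/-! ### Chern curvature of a Hermitian vector bundle, and Griffiths nefness -/

section Curvature

variable {EB : Type*} [NormedAddCommGroup EB] [NormedSpace ℂ EB]
  {r : ℕ} {B : Type*} [TopologicalSpace B] [ChartedSpace EB B]
  {V : B → Type*} [∀ x, AddCommGroup (V x)] [∀ x, Module ℂ (V x)]
  [TopologicalSpace (TotalSpace (Fin r → ℂ) V)] [∀ x, TopologicalSpace (V x)]
  [FiberBundle (Fin r → ℂ) V]

/-- The matrix `(h_{αβ̄})`, `h_{αβ̄} = H(e_α, e_β)`, of a Hermitian metric in the holomorphic frame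
given by the preferred trivialization at `x`, read in the holomorphic coordinates given by the
preferred chart at `x`. -/
def SmoothHermitianMetric.gram (H : SmoothHermitianMetric EB (Fin r → ℂ) V) (x : B) (z : EB) :
    Matrix (Fin r) (Fin r) ℂ :=
  Matrix.of fun α β =>
    H.form ((chartAt EB x).symm z)
      ((trivializationAt (Fin r → ℂ) V x).symm ((chartAt EB x).symm z) (Pi.single α 1))
      ((trivializationAt (Fin r → ℂ) V x).symm ((chartAt EB x).symm z) (Pi.single β 1))

/-- The matrix `∑_{j,k} R_{jk̄αβ̄} uʲ ūᵏ` at `x`, where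
`R_{jk̄αβ̄} = -∂²h_{αβ̄}/∂zⱼ∂z̄ₖ + ∑_{γ,δ} h^{γδ̄} ∂h_{αδ̄}/∂zⱼ ∂h_{γβ̄}/∂z̄ₖ`
are the coefficients of the Chern curvature. -/
def SmoothHermitianMetric.curvatureMatrix (H : SmoothHermitianMetric EB (Fin r → ℂ) V) (x : B)
    (u : TangentSpace 𝓘(ℂ, EB) x) : Matrix (Fin r) (Fin r) ℂ :=
  let z₀ : EB := chartAt EB x x
  let h : EB → Matrix (Fin r) (Fin r) ℂ := H.gram x
  (-Matrix.of fun α β => wirtinger (EB := EB) u (wirtingerBar (EB := EB) u fun z => h z α β) z₀) +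
    (Matrix.of fun α δ => wirtinger (EB := EB) u (fun z => h z α δ) z₀) * (h z₀)⁻¹ *
      (Matrix.of fun γ β => wirtingerBar (EB := EB) u (fun z => h z γ β) z₀)

/-- The number `Θ_H(u ⊗ v, u ⊗ v) = ∑ R_{jk̄αβ̄} uʲ ūᵏ v^α v̄^β`, which is real. -/
def SmoothHermitianMetric.griffithsCurvature (H : SmoothHermitianMetric EB (Fin r → ℂ) V) (x : B)
    (u : TangentSpace 𝓘(ℂ, EB) x) (v : V x) : ℝ :=
  let c : Fin r → ℂ := (trivializationAt (Fin r → ℂ) V x ⟨x, v⟩).2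
  (∑ α, ∑ β, H.curvatureMatrix x u α β * c α * conj (c β)).re

/-- The vector bundle `V` of rank `r` over the Hermitian manifold `(B, G)` is Griffiths nef: for
every `ε > 0` it carries a smooth Hermitian metric `H` such that
`Θ_H(u ⊗ v, u ⊗ v) ≥ -ε ‖u‖²_G ‖v‖²_H` for all `u ∈ T_B`, `v ∈ V`. -/
def IsGriffithsNef [IsManifold 𝓘(ℂ, EB) ω B] (G : HermitianMetricOn EB B) (r : ℕ)
    (V : B → Type*) [∀ x, AddCommGroup (V x)] [∀ x, Module ℂ (V x)]
    [TopologicalSpace (TotalSpace (Fin r → ℂ) V)] [∀ x, TopologicalSpace (V x)]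
    [FiberBundle (Fin r → ℂ) V] : Prop :=
  ∀ ε : ℝ, 0 < ε → ∃ H : SmoothHermitianMetric EB (Fin r → ℂ) V,
    ∀ (x : B) (u : TangentSpace 𝓘(ℂ, EB) x) (v : V x),
      -ε * G.normSq x u * H.normSq x v ≤ H.griffithsCurvature x u v

end Curvature

/-! ### Nef line bundles -/

section LineBundle

variable {EB : Type*} [NormedAddCommGroup EB] [NormedSpace ℂ EB]
  {B : Type*} [TopologicalSpace B] [ChartedSpace EB B]

/-- The Chern curvature form `i Θ_h = -i ∂∂̄ log ‖s‖²_h` (`s` a local holomorphic frame) of a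
Hermitian line bundle, as the real quadratic form `u ↦ -∑_{j,k} ∂²(log ‖s‖²_h)/∂zⱼ∂z̄ₖ uʲ ūᵏ` on the
holomorphic tangent space at `x`. The frame is the one of the preferred trivialization at `x`, and
the coordinates are those of the preferred chart at `x`. -/
def SmoothHermitianMetric.lineCurvature
    {L : B → Type*} [∀ x, AddCommGroup (L x)] [∀ x, Module ℂ (L x)]
    [TopologicalSpace (TotalSpace ℂ L)] [∀ x, TopologicalSpace (L x)] [FiberBundle ℂ L]
    (h : SmoothHermitianMetric EB ℂ L) (x : B) (u : TangentSpace 𝓘(ℂ, EB) x) : ℝ :=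
  let φ : EB → ℂ := fun z =>
    (Real.log (h.normSq ((chartAt EB x).symm z)
      ((trivializationAt ℂ L x).symm ((chartAt EB x).symm z) 1)) : ℂ)
  (-wirtinger (EB := EB) u (wirtingerBar (EB := EB) u φ) (chartAt EB x x)).re

/-- A holomorphic line bundle `L` over a (compact) complex manifold `B` is nef, in the sense of
Demailly, Peternell and Schneider: for every Hermitian metric `g` on `B` and every `ε > 0` there is
a smooth Hermitian metric `h` on `L` with `i Θ_h ≥ -ε g`. -/
def IsNefLineBundle (EB : Type*) [NormedAddCommGroup EB] [NormedSpace ℂ EB]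
    {B : Type*} [TopologicalSpace B] [ChartedSpace EB B] [IsManifold 𝓘(ℂ, EB) ω B]
    (L : B → Type*) [∀ x, AddCommGroup (L x)] [∀ x, Module ℂ (L x)]
    [TopologicalSpace (TotalSpace ℂ L)] [∀ x, TopologicalSpace (L x)] [FiberBundle ℂ L]
    [VectorBundle ℂ ℂ L] [ContMDiffVectorBundle ω ℂ L 𝓘(ℂ, EB)] : Prop :=
  ∀ g : HermitianMetricOn EB B, ∀ ε : ℝ, 0 < ε → ∃ h : SmoothHermitianMetric EB ℂ L,
    ∀ (x : B) (u : TangentSpace 𝓘(ℂ, EB) x), -ε * g.normSq x u ≤ h.lineCurvature x u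

end LineBundle

/-! ### The projectivized dual bundle `ℙ(E^*)` as a complex manifold -/

/-- The bundle `ℙ(E^*)` of lines in the fibres of the dual `E^*` of a vector bundle `E` of rank
`k + 1` over a complex manifold modelled on `EM`. The parameters `EM` and `k` only serve to find
the complex structure. -/
@[nolint unusedArguments]
def DualProj (_EM : Type*) (_k : ℕ) {M : Type*} (E : M → Type*) [∀ x, AddCommGroup (E x)]
    [∀ x, Module ℂ (E x)] : Type _ :=
  Σ x : M, Projectivization ℂ (Module.Dual ℂ (E x))

namespace DualProj

section LinearAlgebra

variable {EM : Type*} {k : ℕ} {M : Type*} [TopologicalSpace M]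
  {E : M → Type*} [∀ x, AddCommGroup (E x)] [∀ x, Module ℂ (E x)]
  [TopologicalSpace (TotalSpace (Fin (k + 1) → ℂ) E)] [∀ x, TopologicalSpace (E x)]
  [FiberBundle (Fin (k + 1) → ℂ) E] [VectorBundle ℂ (Fin (k + 1) → ℂ) E]

variable (k E) in
/-- The holomorphic local frame `e_0, …, e_k` of `E` given by the trivialization at `x₀`. -/
def frame (x₀ : M) (i : Fin (k + 1)) (x : M) : E x :=
  (trivializationAt (Fin (k + 1) → ℂ) E x₀).symm x (Pi.single i 1)

variable (E) in
/-- The linear form `∑ᵢ Wᵢ eⁱ` on `E_x`, where `e⁰, …, eᵏ` is the dual of the frame at `x₀`. -/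
def covector (x₀ : M) (W : Fin (k + 1) → ℂ) (x : M) : Module.Dual ℂ (E x) :=
  ∑ i, W i • (LinearMap.proj i ∘ₗ
    (trivializationAt (Fin (k + 1) → ℂ) E x₀).linearMapAt ℂ x)

/-- The homogeneous coordinates `W₀, …, W_k` of (the chosen representative of) a point of
`ℙ(E^*)`, with respect to the frame at `x₀`. -/
def hcoord (x₀ : M) (p : DualProj EM k E) (i : Fin (k + 1)) : ℂ :=
  p.2.rep (frame k E x₀ i p.1)

variable (E) in
/-- The matrix `A` of the change of frame: `e¹ᵢ = ∑ₘ A_{mi} e⁰ₘ`, with `e⁰` the frame at `x₀` and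
`e¹` the frame at `x₁`. -/
def transition (x₀ x₁ x : M) (m i : Fin (k + 1)) : ℂ :=
  (trivializationAt (Fin (k + 1) → ℂ) E x₀).linearMapAt ℂ x (frame k E x₁ i x) m


variable (k E) in
/-- The trivialization at `x₀` if it is defined at `x`, and the one at `x` otherwise. -/
def center (x₀ x : M) : M :=
  open Classical in if x ∈ (trivializationAt (Fin (k + 1) → ℂ) E x₀).baseSet then x₀ else x

theorem mem_center (x₀ x : M) :
    x ∈ (trivializationAt (Fin (k + 1) → ℂ) E (center k E x₀ x)).baseSet := by
  unfold center
  split_ifs with h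
  · exact h
  · exact mem_baseSet_trivializationAt _ _ x

theorem linearMapAt_frame {x₀ x : M}
    (hx : x ∈ (trivializationAt (Fin (k + 1) → ℂ) E x₀).baseSet) (i : Fin (k + 1)) :
    (trivializationAt (Fin (k + 1) → ℂ) E x₀).linearMapAt ℂ x (frame k E x₀ i x) =
      Pi.single i 1 := by
  have := (trivializationAt (Fin (k + 1) → ℂ) E x₀).linearMapAt_symmₗ (R := ℂ) hx (Pi.single i 1)
  rwa [Trivialization.coe_symmₗ _ hx] at this

theorem sum_smul_frame {x₀ x : M}
    (hx : x ∈ (trivializationAt (Fin (k + 1) → ℂ) E x₀).baseSet) (v : E x) :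
    ∑ m, ((trivializationAt (Fin (k + 1) → ℂ) E x₀).linearMapAt ℂ x v m) • frame k E x₀ m x = v := by
  have h := (trivializationAt (Fin (k + 1) → ℂ) E x₀).symmₗ_linearMapAt (R := ℂ) hx v
  conv_rhs => rw [← h]
  generalize (trivializationAt (Fin (k + 1) → ℂ) E x₀).linearMapAt ℂ x v = c
  conv_rhs => rw [pi_eq_sum_univ' c, map_sum]
  refine Finset.sum_congr rfl fun m _ => ?_
  rw [map_smul]
  congr 2
  unfold frame
  rw [Trivialization.coe_symmₗ _ hx]

theorem covector_frame (x₀ x₁ : M) (W : Fin (k + 1) → ℂ) (x : M) (i : Fin (k + 1)) :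
    covector E x₀ W x (frame k E x₁ i x) = ∑ m, W m * transition E x₀ x₁ x m i := by
  simp [covector, transition]

theorem covector_frame_self {x₀ x : M}
    (hx : x ∈ (trivializationAt (Fin (k + 1) → ℂ) E x₀).baseSet) (W : Fin (k + 1) → ℂ)
    (i : Fin (k + 1)) : covector E x₀ W x (frame k E x₀ i x) = W i := by
  simp [covector_frame, transition, linearMapAt_frame hx, Pi.single_apply]

theorem covector_ne_zero {x₀ x : M}
    (hx : x ∈ (trivializationAt (Fin (k + 1) → ℂ) E x₀).baseSet) {W : Fin (k + 1) → ℂ}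
    (hW : W ≠ 0) : covector E x₀ W x ≠ 0 := by
  intro h
  apply hW
  funext i
  rw [← covector_frame_self hx W i, h]
  rfl

theorem dual_ext {x₀ x : M} (hx : x ∈ (trivializationAt (Fin (k + 1) → ℂ) E x₀).baseSet)
    {ξ η : Module.Dual ℂ (E x)} (h : ∀ i, ξ (frame k E x₀ i x) = η (frame k E x₀ i x)) : ξ = η := by
  ext v
  rw [← sum_smul_frame hx v]
  simp [h]

variable (EM E) in
/-- The point of `ℙ(E^*)` over `x` with homogeneous coordinates `W` in the frame at `x₀`
(a junk value if the frame is not defined at `x`). -/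
def point (x₀ : M) (W : Fin (k + 1) → ℂ) (hW : W ≠ 0) (x : M) : DualProj EM k E :=
  ⟨x, Projectivization.mk ℂ (covector E (center k E x₀ x) W x) (covector_ne_zero (mem_center x₀ x) hW)⟩

theorem hcoord_eq_sum {x₀ : M} (x₁ : M) {p : DualProj EM k E}
    (hx : p.1 ∈ (trivializationAt (Fin (k + 1) → ℂ) E x₀).baseSet) (i : Fin (k + 1)) :
    hcoord x₁ p i = ∑ m, hcoord x₀ p m * transition E x₀ x₁ p.1 m i := by
  have := sum_smul_frame hx (frame k E x₁ i p.1)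
  unfold hcoord
  conv_lhs => rw [← this, map_sum]
  simp [transition, mul_comm]

theorem exists_hcoord_ne_zero {x₀ : M} {p : DualProj EM k E}
    (hx : p.1 ∈ (trivializationAt (Fin (k + 1) → ℂ) E x₀).baseSet) :
    ∃ i, hcoord x₀ p i ≠ 0 := by
  by_contra! h
  exact p.2.rep_nonzero (dual_ext hx (by simpa [hcoord] using h))

theorem exists_hcoord_point {x₀ x : M}
    (hx : x ∈ (trivializationAt (Fin (k + 1) → ℂ) E x₀).baseSet) (W : Fin (k + 1) → ℂ)
    (hW : W ≠ 0) :
    ∃ c : ℂ, c ≠ 0 ∧ ∀ x₁ i, hcoord x₁ (point EM E x₀ W hW x) i =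
      c * ∑ m, W m * transition E x₀ x₁ x m i := by
  have hc : center k E x₀ x = x₀ := by simp [center, hx]
  obtain ⟨a, ha⟩ := Projectivization.exists_smul_eq_mk_rep ℂ (covector E (center k E x₀ x) W x)
    (covector_ne_zero (mem_center x₀ x) hW)
  refine ⟨a, a.ne_zero, fun x₁ i => ?_⟩
  change (Projectivization.mk ℂ (covector E (center k E x₀ x) W x)
    (covector_ne_zero (mem_center x₀ x) hW)).rep (frame k E x₁ i x) = _
  rw [← ha, hc, ← covector_frame]
  rfl

theorem transition_self {x₀ x : M}
    (hx : x ∈ (trivializationAt (Fin (k + 1) → ℂ) E x₀).baseSet) (m i : Fin (k + 1)) :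
    transition E x₀ x₀ x m i = if m = i then 1 else 0 := by
  simp [transition, linearMapAt_frame hx, Pi.single_apply]

/-- The vector of homogeneous coordinates with `j`-th coordinate `1` and the other ones `w`. -/
def insertOne (j : Fin (k + 1)) (w : Fin k → ℂ) : Fin (k + 1) → ℂ := Fin.insertNth j 1 w

theorem insertOne_ne_zero (j : Fin (k + 1)) (w : Fin k → ℂ) : insertOne j w ≠ 0 := fun h => by
  have := congrFun h j
  simp [insertOne] at this

end LinearAlgebra

section Charts

variable {EM : Type*} [NormedAddCommGroup EM] [NormedSpace ℂ EM]
  {k : ℕ} {M : Type*} [TopologicalSpace M] [ChartedSpace EM M]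
  {E : M → Type*} [∀ x, AddCommGroup (E x)] [∀ x, Module ℂ (E x)]
  [TopologicalSpace (TotalSpace (Fin (k + 1) → ℂ) E)] [∀ x, TopologicalSpace (E x)]
  [FiberBundle (Fin (k + 1) → ℂ) E] [VectorBundle ℂ (Fin (k + 1) → ℂ) E]

variable (EM k E) in
/-- The domain on which the chart and the trivialization at `x₀` are both defined. -/
def chartBase (x₀ : M) : Set M :=
  (chartAt EM x₀).source ∩ (trivializationAt (Fin (k + 1) → ℂ) E x₀).baseSet

variable (EM E) in
/-- The standard chart of `ℙ(E^*)` attached to `x₀ : M` and `j : Fin (k + 1)`: on the open set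
where `W_j ≠ 0`, the coordinates are the coordinates `z` of the base point in the chart at `x₀`
and the affine coordinates `w = (Wᵢ / W_j)_{i ≠ j}`, where `W` are the homogeneous coordinates
with respect to the frame at `x₀`. -/
def chart (x₀ : M) (j : Fin (k + 1)) : PartialEquiv (DualProj EM k E) (EM × (Fin k → ℂ)) where
  toFun p := (chartAt EM x₀ p.1, fun i => hcoord x₀ p (j.succAbove i) / hcoord x₀ p j)
  invFun q := point EM E x₀ (insertOne j q.2) (insertOne_ne_zero j q.2) ((chartAt EM x₀).symm q.1)
  source := {p | p.1 ∈ chartBase EM k E x₀ ∧ hcoord x₀ p j ≠ 0}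
  target := {q | q.1 ∈ (chartAt EM x₀).target ∧ (chartAt EM x₀).symm q.1 ∈ chartBase EM k E x₀}
  map_source' := by
    rintro p ⟨hp, -⟩
    refine ⟨(chartAt EM x₀).map_source hp.1, ?_⟩
    simpa [(chartAt EM x₀).left_inv hp.1] using hp
  map_target' := by
    rintro ⟨z, w⟩ ⟨hz, hb⟩
    refine ⟨by exact hb, ?_⟩
    obtain ⟨c, hc, h⟩ := exists_hcoord_point (EM := EM) (E := E) hb.2 (insertOne j w)
      (insertOne_ne_zero j w)
    dsimp only
    rw [h]
    simp [hc, transition_self hb.2, insertOne]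
  left_inv' := by
    rintro ⟨x, p⟩ ⟨⟨hx, hb⟩, hj⟩
    change point EM E x₀ (insertOne j fun i => hcoord x₀ (⟨x, p⟩ : DualProj EM k E) (j.succAbove i) /
      hcoord x₀ (⟨x, p⟩ : DualProj EM k E) j) (insertOne_ne_zero _ _)
      ((chartAt EM x₀).symm (chartAt EM x₀ x)) = _
    rw [(chartAt EM x₀).left_inv hx]
    have hc : center k E x₀ x = x₀ := by simp [center, hb]
    unfold point
    congr 1
    dsimp only
    conv_rhs => rw [← Projectivization.mk_rep p]
    rw [Projectivization.mk_eq_mk_iff']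
    refine ⟨(@hcoord EM k M _ E _ _ _ _ _ x₀ ⟨x, p⟩ j)⁻¹, ?_⟩
    rw [hc]
    apply dual_ext hb
    intro i
    rw [covector_frame_self hb]
    change (@hcoord EM k M _ E _ _ _ _ _ x₀ ⟨x, p⟩ j)⁻¹ * @hcoord EM k M _ E _ _ _ _ _ x₀ ⟨x, p⟩ i = _
    rcases Fin.eq_self_or_eq_succAbove j i with rfl | ⟨l, rfl⟩
    · simp [insertOne, inv_mul_cancel₀ hj]
    · simp [insertOne, div_eq_inv_mul]
  right_inv' := by
    rintro ⟨z, w⟩ ⟨hz, hb⟩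
    obtain ⟨c, hc, h⟩ := exists_hcoord_point (EM := EM) (E := E) hb.2 (insertOne j w)
      (insertOne_ne_zero j w)
    refine Prod.ext (by exact (chartAt EM x₀).right_inv hz) ?_
    funext i
    dsimp only
    rw [h, h]
    simp [transition_self hb.2, insertOne, hc]

variable (E) in
/-- The homogeneous coordinates `Wᵢ` with respect to the frame at `x₁` of the point with coordinates
`q = (z, w)` in the chart attached to `(x₀, j)`, normalized by `W_j = 1` in the frame at `x₀`. -/
def newCoord (x₀ : M) (j : Fin (k + 1)) (x₁ : M) (i : Fin (k + 1)) (q : EM × (Fin k → ℂ)) : ℂ :=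
  ∑ m, insertOne j q.2 m * transition E x₀ x₁ ((chartAt EM x₀).symm q.1) m i

variable (EM k E) in
/-- The domain of `newCoord`. -/
def newDomain (x₀ x₁ : M) : Set (EM × (Fin k → ℂ)) :=
  {q | q.1 ∈ (chartAt EM x₀).target ∧
    (chartAt EM x₀).symm q.1 ∈ chartBase EM k E x₀ ∩ chartBase EM k E x₁}

theorem isOpen_newDomain (x₀ x₁ : M) : IsOpen (newDomain EM k E x₀ x₁) := by
  have h : IsOpen (chartBase EM k E x₀ ∩ chartBase EM k E x₁) :=
    ((chartAt EM x₀).open_source.inter (trivializationAt _ E x₀).open_baseSet).inter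
      ((chartAt EM x₁).open_source.inter (trivializationAt _ E x₁).open_baseSet)
  exact ((chartAt EM x₀).isOpen_inter_preimage_symm h).preimage continuous_fst

theorem hcoord_chart_symm {x₀ : M} {j : Fin (k + 1)} {q : EM × (Fin k → ℂ)}
    (hq : q ∈ (chart EM E x₀ j).target) :
    ∃ c : ℂ, c ≠ 0 ∧ ∀ x₁ i, hcoord x₁ ((chart EM E x₀ j).symm q) i =
      c * newCoord E x₀ j x₁ i q :=
  exists_hcoord_point hq.2.2 (insertOne j q.2) (insertOne_ne_zero j q.2)

theorem trans_source (x₀ x₁ : M) (j l : Fin (k + 1)) :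
    ((chart EM E x₀ j).symm.trans (chart EM E x₁ l)).source =
      newDomain EM k E x₀ x₁ ∩ newCoord E x₀ j x₁ l ⁻¹' {0}ᶜ := by
  ext q
  constructor
  · rintro ⟨hq, hq'⟩
    obtain ⟨c, hc, h⟩ := hcoord_chart_symm hq
    refine ⟨⟨hq.1, hq.2, hq'.1⟩, fun h0 => hq'.2 ?_⟩
    exact (h x₁ l).trans (by rw [h0, mul_zero])
  · rintro ⟨⟨h1, h2, h3⟩, hne⟩
    have hq : q ∈ (chart EM E x₀ j).target := ⟨h1, h2⟩
    obtain ⟨c, hc, h⟩ := hcoord_chart_symm hq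
    exact ⟨hq, h3, fun h0 => mul_ne_zero hc hne ((h x₁ l).symm.trans h0)⟩

theorem trans_apply (x₀ x₁ : M) (j l : Fin (k + 1)) {q : EM × (Fin k → ℂ)}
    (hq : q ∈ ((chart EM E x₀ j).symm.trans (chart EM E x₁ l)).source) :
    (chart EM E x₀ j).symm.trans (chart EM E x₁ l) q =
      (chartAt EM x₁ ((chartAt EM x₀).symm q.1),
        fun i => newCoord E x₀ j x₁ (l.succAbove i) q / newCoord E x₀ j x₁ l q) := by
  obtain ⟨c, hc, h⟩ := hcoord_chart_symm hq.1
  refine Prod.ext rfl ?_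
  funext i
  change hcoord x₁ ((chart EM E x₀ j).symm q) _ / hcoord x₁ ((chart EM E x₀ j).symm q) _ = _
  rw [h, h, mul_div_mul_left _ _ hc]

section Holomorphic

variable [ContMDiffVectorBundle ω (Fin (k + 1) → ℂ) E 𝓘(ℂ, EM)]

theorem contMDiffOn_transition (x₀ x₁ : M) (m i : Fin (k + 1)) :
    ContMDiffOn 𝓘(ℂ, EM) 𝓘(ℂ, ℂ) ω (fun x => transition E x₀ x₁ x m i)
      (chartBase EM k E x₀ ∩ chartBase EM k E x₁) := by
  have h := contMDiffOn_coordChangeL (n := ω) (IB := 𝓘(ℂ, EM))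
    (trivializationAt (Fin (k + 1) → ℂ) E x₁) (trivializationAt (Fin (k + 1) → ℂ) E x₀)
  have h2 : ContMDiffOn 𝓘(ℂ, EM) 𝓘(ℂ, ℂ) ω
      (fun x => ((ContinuousLinearMap.proj (R := ℂ) (φ := fun _ : Fin (k + 1) => ℂ) m).comp
        ((trivializationAt (Fin (k + 1) → ℂ) E x₁).coordChangeL ℂ
          (trivializationAt (Fin (k + 1) → ℂ) E x₀) x :
            (Fin (k + 1) → ℂ) →L[ℂ] (Fin (k + 1) → ℂ))) (Pi.single i 1))
      ((trivializationAt (Fin (k + 1) → ℂ) E x₁).baseSet ∩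
        (trivializationAt (Fin (k + 1) → ℂ) E x₀).baseSet) :=
    (contMDiffOn_const.clm_comp h).clm_apply contMDiffOn_const
  refine (h2.mono fun x hx => ⟨hx.2.2, hx.1.2⟩).congr fun x hx => ?_
  have hx' : x ∈ (trivializationAt (Fin (k + 1) → ℂ) E x₁).baseSet ∩
      (trivializationAt (Fin (k + 1) → ℂ) E x₀).baseSet := ⟨hx.2.2, hx.1.2⟩
  simp only [ContinuousLinearMap.comp_apply, ContinuousLinearMap.proj_apply,
    ContinuousLinearEquiv.coe_coe]
  rw [Trivialization.coordChangeL_apply _ _ hx']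
  unfold transition frame
  rw [Trivialization.coe_linearMapAt_of_mem _ hx'.2]

variable [IsManifold 𝓘(ℂ, EM) ω M]

theorem contDiffOn_newCoord (x₀ : M) (j : Fin (k + 1)) (x₁ : M) (i : Fin (k + 1)) :
    ContDiffOn ℂ ω (newCoord E x₀ j x₁ i) (newDomain EM k E x₀ x₁) := by
  refine ContDiffOn.sum fun m _ => ContDiffOn.mul ?_ ?_
  · apply ContDiff.contDiffOn
    rcases Fin.eq_self_or_eq_succAbove j m with rfl | ⟨l, rfl⟩
    · simpa [insertOne] using contDiff_const
    · simp only [insertOne, Fin.insertNth_apply_succAbove]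
      fun_prop
  · have h : ContDiffOn ℂ ω
        ((fun x => transition E x₀ x₁ x m i) ∘ (chartAt EM x₀).symm)
        ((chartAt EM x₀).target ∩ (chartAt EM x₀).symm ⁻¹'
          (chartBase EM k E x₀ ∩ chartBase EM k E x₁)) := by
      rw [← contMDiffOn_iff_contDiffOn]
      exact (contMDiffOn_transition x₀ x₁ m i).comp
        ((contMDiffOn_chart_symm (I := 𝓘(ℂ, EM)) (x := x₀)).mono inter_subset_left)
        fun x hx => hx.2
    exact h.comp contDiff_fst.contDiffOn fun q hq => hq

theorem contDiffOn_trans (x₀ x₁ : M) (j l : Fin (k + 1)) :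
    ContDiffOn ℂ ω ((chart EM E x₀ j).symm.trans (chart EM E x₁ l))
      ((chart EM E x₀ j).symm.trans (chart EM E x₁ l)).source := by
  refine ContDiffOn.congr ?_ fun q hq => trans_apply x₀ x₁ j l hq
  rw [trans_source]
  refine ContDiffOn.prodMk ?_ ?_
  · have h : ContDiffOn ℂ ω (chartAt EM x₁ ∘ (chartAt EM x₀).symm)
        ((chartAt EM x₀).target ∩ (chartAt EM x₀).symm ⁻¹'
          (chartBase EM k E x₀ ∩ chartBase EM k E x₁)) := by
      rw [← contMDiffOn_iff_contDiffOn]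
      exact (contMDiffOn_chart (I := 𝓘(ℂ, EM)) (x := x₁)).comp
        ((contMDiffOn_chart_symm (I := 𝓘(ℂ, EM)) (x := x₀)).mono inter_subset_left)
        fun x hx => hx.2.2.1
    exact h.comp contDiff_fst.contDiffOn fun q hq => hq.1
  · rw [contDiffOn_pi]
    intro i
    exact ((contDiffOn_newCoord x₀ j x₁ _).mono inter_subset_left).div
      ((contDiffOn_newCoord x₀ j x₁ _).mono inter_subset_left) fun q hq => hq.2

/-- An index `j` with `W_j ≠ 0`, for the homogeneous coordinates in the preferred frame. -/
def indexAt (p : DualProj EM k E) : Fin (k + 1) :=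
  (exists_hcoord_ne_zero (x₀ := p.1) (mem_baseSet_trivializationAt _ E p.1)).choose

theorem hcoord_indexAt (p : DualProj EM k E) : hcoord p.1 p (indexAt p) ≠ 0 :=
  (exists_hcoord_ne_zero (x₀ := p.1) (mem_baseSet_trivializationAt _ E p.1)).choose_spec

theorem mem_chartAt_source (p : DualProj EM k E) : p ∈ (chart EM E p.1 (indexAt p)).source :=
  ⟨⟨ChartedSpace.mem_chart_source (H := EM) p.1, mem_baseSet_trivializationAt _ E p.1⟩, hcoord_indexAt p⟩

variable (EM k E) in
/-- The standard charts of `ℙ(E^*)`. -/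
def core : ChartedSpaceCore (EM × (Fin k → ℂ)) (DualProj EM k E) where
  atlas := {e | ∃ x₀ j, e = chart EM E x₀ j}
  chartAt p := chart EM E p.1 (indexAt p)
  mem_chart_source := mem_chartAt_source
  chart_mem_atlas p := ⟨_, _, rfl⟩
  open_source := by
    rintro _ _ ⟨x₀, j, rfl⟩ ⟨x₁, l, rfl⟩
    rw [trans_source]
    exact (contDiffOn_newCoord x₀ j x₁ l).continuousOn.isOpen_inter_preimage
      (isOpen_newDomain x₀ x₁) isOpen_compl_singleton
  continuousOn_toFun := by
    rintro _ _ ⟨x₀, j, rfl⟩ ⟨x₁, l, rfl⟩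
    exact (contDiffOn_trans x₀ x₁ j l).continuousOn

/-- The topology of `ℙ(E^*)`. -/
instance : TopologicalSpace (DualProj EM k E) := (core EM k E).toTopologicalSpace

/-- The atlas of `ℙ(E^*)` consisting of the standard charts. -/
instance : ChartedSpace (EM × (Fin k → ℂ)) (DualProj EM k E) := (core EM k E).toChartedSpace

/-- `ℙ(E^*)` is a complex manifold. -/
instance : IsManifold 𝓘(ℂ, EM × (Fin k → ℂ)) ω (DualProj EM k E) := by
  apply isManifold_of_contDiffOn
  intro e e' he he'
  obtain ⟨f, hf⟩ := mem_iUnion.1 he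
  obtain ⟨⟨x₀, j, rfl⟩, rfl⟩ := mem_iUnion.1 hf
  obtain ⟨f', hf'⟩ := mem_iUnion.1 he'
  obtain ⟨⟨x₁, l, rfl⟩, rfl⟩ := mem_iUnion.1 hf'
  simp only [modelWithCornersSelf_coe, modelWithCornersSelf_coe_symm, Function.comp_id,
    Function.id_comp, preimage_id, range_id, inter_univ]
  exact contDiffOn_trans x₀ x₁ j l

end Holomorphic
end Charts

/-! ### The line bundle `𝒪(1)` on `ℙ(E^*)` -/

/-- The fibre of `𝒪(1)` at the point of `ℙ(E^*)` given by a line in `E_x^*`: the dual space of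
this line. -/
@[nolint unusedArguments]
def O1 (EM : Type*) (k : ℕ) {M : Type*} (E : M → Type*) [∀ x, AddCommGroup (E x)]
    [∀ x, Module ℂ (E x)] (p : DualProj EM k E) : Type _ :=
  Module.Dual ℂ p.2.submodule

section Fibre

variable {EM : Type*} {k : ℕ} {M : Type*} {E : M → Type*} [∀ x, AddCommGroup (E x)]
  [∀ x, Module ℂ (E x)]

instance (p : DualProj EM k E) : AddCommGroup (O1 EM k E p) :=
  inferInstanceAs (AddCommGroup (Module.Dual ℂ p.2.submodule))

instance (p : DualProj EM k E) : Module ℂ (O1 EM k E p) :=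
  inferInstanceAs (Module ℂ (Module.Dual ℂ p.2.submodule))

/-- The chosen generator of the line given by a point of `ℙ(E^*)`. -/
def generator (p : DualProj EM k E) : p.2.submodule :=
  ⟨p.2.rep, by
    rw [Projectivization.submodule_eq]
    exact Submodule.mem_span_singleton_self _⟩

theorem exists_eq_smul_generator (p : DualProj EM k E) (ξ : p.2.submodule) :
    ∃ a : ℂ, ξ = a • generator p := by
  obtain ⟨ξ, hξ⟩ := ξ
  rw [Projectivization.submodule_eq, Submodule.mem_span_singleton] at hξ
  obtain ⟨a, rfl⟩ := hξ
  exact ⟨a, rfl⟩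

end Fibre

section LineBundle

variable {EM : Type*} [NormedAddCommGroup EM] [NormedSpace ℂ EM]
  {k : ℕ} {M : Type*} [TopologicalSpace M] [ChartedSpace EM M]
  {E : M → Type*} [∀ x, AddCommGroup (E x)] [∀ x, Module ℂ (E x)]
  [TopologicalSpace (TotalSpace (Fin (k + 1) → ℂ) E)] [∀ x, TopologicalSpace (E x)]
  [FiberBundle (Fin (k + 1) → ℂ) E] [VectorBundle ℂ (Fin (k + 1) → ℂ) E]

/-- The element of `𝒪(1)_p` given by the `j`-th homogeneous coordinate with respect to the frame
at `x₀`: the restriction of the linear form `ξ ↦ ξ(e_j)` on `E_x^*` to the line given by `p`. -/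
def coordForm (x₀ : M) (j : Fin (k + 1)) (p : DualProj EM k E) : O1 EM k E p :=
  (LinearMap.applyₗ (frame k E x₀ j p.1)).comp p.2.submodule.subtype

/-- The vector `ξ` of the line given by `p` with `ξ(e_j) = 1`, where `e` is the frame at `x₀`. -/
def unitVec (x₀ : M) (j : Fin (k + 1)) (p : DualProj EM k E) : p.2.submodule :=
  (hcoord x₀ p j)⁻¹ • generator p

/-- The value of an element of `𝒪(1)_p` on a vector of the line given by `p`. -/
def evalAt {p : DualProj EM k E} (ξ : p.2.submodule) : O1 EM k E p →ₗ[ℂ] ℂ :=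
  LinearMap.applyₗ (R := ℂ) (M := p.2.submodule) (M₂ := ℂ) ξ

theorem evalAt_unitVec_coordForm (x₀ x₁ : M) (j l : Fin (k + 1)) (p : DualProj EM k E) :
    evalAt (unitVec x₁ l p) (coordForm x₀ j p) = hcoord x₀ p j / hcoord x₁ p l := by
  rw [div_eq_inv_mul]
  rfl

theorem evalAt_smul_coordForm {x₀ : M} {j : Fin (k + 1)} {p : DualProj EM k E}
    (hp : hcoord x₀ p j ≠ 0) (s : O1 EM k E p) :
    evalAt (unitVec x₀ j p) s • coordForm x₀ j p = s := by
  have hsm : ∀ (a : ℂ) (ξ : p.2.submodule) (t : O1 EM k E p),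
      evalAt (a • ξ) t = a * evalAt ξ t := fun a ξ t =>
    map_smul (show Module.Dual ℂ p.2.submodule from t) a ξ
  refine LinearMap.ext (M := p.2.submodule) (M₃ := ℂ) fun ξ => ?_
  obtain ⟨a, rfl⟩ := exists_eq_smul_generator p ξ
  change evalAt (a • generator p) (evalAt (unitVec x₀ j p) s • coordForm x₀ j p) =
    evalAt (a • generator p) s
  have h : evalAt (generator p) (coordForm x₀ j p) = hcoord x₀ p j := rfl
  rw [map_smul, hsm, hsm, unitVec, hsm, h, smul_eq_mul]
  field_simp

variable [ContMDiffVectorBundle ω (Fin (k + 1) → ℂ) E 𝓘(ℂ, EM)] [IsManifold 𝓘(ℂ, EM) ω M]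

/-- The topology of the fibres of `𝒪(1)`, which are complex lines. -/
instance (p : DualProj EM k E) : TopologicalSpace (O1 EM k E p) :=
  TopologicalSpace.induced (evalAt (unitVec p.1 (indexAt p) p)) inferInstance

theorem isOpen_chart_source (x₀ : M) (j : Fin (k + 1)) : IsOpen (chart EM E x₀ j).source :=
  (core EM k E).open_source' ⟨x₀, j, rfl⟩

/-- The local trivialization of `𝒪(1)` on the domain of the chart attached to `(x₀, j)`, given by
the frame `coordForm x₀ j`. -/
def pretriv (x₀ : M) (j : Fin (k + 1)) : Pretrivialization ℂ (π ℂ (O1 EM k E)) where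
  toFun s := (s.1, evalAt (unitVec x₀ j s.1) s.2)
  invFun q := ⟨q.1, q.2 • coordForm x₀ j q.1⟩
  source := π ℂ (O1 EM k E) ⁻¹' (chart EM E x₀ j).source
  target := (chart EM E x₀ j).source ×ˢ univ
  map_source' s hs := ⟨hs, trivial⟩
  map_target' q hq := hq.1
  left_inv' := by
    rintro ⟨p, s⟩ hs
    exact congrArg (TotalSpace.mk p) (evalAt_smul_coordForm hs.2 s)
  right_inv' := by
    rintro ⟨p, c⟩ ⟨hp, -⟩
    refine Prod.ext rfl ?_
    dsimp only
    rw [map_smul, evalAt_unitVec_coordForm, div_self hp.2, smul_eq_mul, mul_one]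
  open_target := (isOpen_chart_source x₀ j).prod isOpen_univ
  baseSet := (chart EM E x₀ j).source
  open_baseSet := isOpen_chart_source x₀ j
  source_eq := rfl
  target_eq := rfl
  proj_toFun _ _ := rfl

instance (x₀ : M) (j : Fin (k + 1)) :
    (pretriv x₀ j : Pretrivialization ℂ (π ℂ (O1 EM k E))).IsLinear ℂ where
  linear p _ := (evalAt (unitVec x₀ j p)).isLinear

theorem pretriv_symm_apply {x₀ : M} {j : Fin (k + 1)} {p : DualProj EM k E}
    (hp : p ∈ (chart EM E x₀ j).source) (c : ℂ) :
    (pretriv x₀ j : Pretrivialization ℂ (π ℂ (O1 EM k E))).symm p c = c • coordForm x₀ j p :=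
  Pretrivialization.symm_apply _ hp c

theorem contMDiffOn_chart (x₀ : M) (j : Fin (k + 1)) :
    ContMDiffOn 𝓘(ℂ, EM × (Fin k → ℂ)) 𝓘(ℂ, EM × (Fin k → ℂ)) ω (chart EM E x₀ j)
      (chart EM E x₀ j).source :=
  contMDiffOn_of_mem_maximalAtlas (e := (core EM k E).openPartialHomeomorph (chart EM E x₀ j)
    ⟨x₀, j, rfl⟩) (IsManifold.subset_maximalAtlas
      (mem_iUnion.2 ⟨_, mem_iUnion.2 ⟨⟨x₀, j, rfl⟩, rfl⟩⟩))

theorem contMDiffOn_ratio (x₀ x₁ : M) (j l : Fin (k + 1)) :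
    ContMDiffOn 𝓘(ℂ, EM × (Fin k → ℂ)) 𝓘(ℂ, ℂ) ω
      (fun p : DualProj EM k E => hcoord x₀ p j / hcoord x₁ p l)
      ((chart EM E x₀ j).source ∩ (chart EM E x₁ l).source) := by
  have key : ∀ p ∈ (chart EM E x₀ j).source, ∃ c : ℂ, c ≠ 0 ∧ ∀ x₁ i, hcoord x₁ p i =
      c * newCoord E x₀ j x₁ i (chart EM E x₀ j p) := fun p hp => by
    have := hcoord_chart_symm ((chart EM E x₀ j).map_source hp)
    rwa [(chart EM E x₀ j).left_inv hp] at this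
  have hself : ∀ p ∈ (chart EM E x₀ j).source,
      newCoord E x₀ j x₀ j (chart EM E x₀ j p) = 1 := fun p hp => by
    have hb := ((chart EM E x₀ j).map_source hp).2.2
    simp [newCoord, transition_self hb, insertOne]
  have h1 : ContMDiffOn 𝓘(ℂ, EM × (Fin k → ℂ)) 𝓘(ℂ, ℂ) ω
      ((fun q => (newCoord E x₀ j x₁ l q)⁻¹) ∘ chart EM E x₀ j)
      ((chart EM E x₀ j).source ∩ (chart EM E x₁ l).source) := by
    refine ContMDiffOn.comp (t := newDomain EM k E x₀ x₁ ∩ newCoord E x₀ j x₁ l ⁻¹' {0}ᶜ)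
      (contMDiffOn_iff_contDiffOn.2 (((contDiffOn_newCoord x₀ j x₁ l).mono
        inter_subset_left).inv fun q hq => hq.2))
      ((contMDiffOn_chart x₀ j).mono inter_subset_left) ?_
    rintro p ⟨hp, hp'⟩
    rw [← trans_source]
    refine ⟨(chart EM E x₀ j).map_source hp, ?_⟩
    change (chart EM E x₀ j).symm (chart EM E x₀ j p) ∈ (chart EM E x₁ l).source
    rwa [(chart EM E x₀ j).left_inv hp]
  refine h1.congr ?_
  rintro p ⟨hp, hp'⟩
  obtain ⟨c, hc, h⟩ := key p hp
  rw [h, h, hself p hp, mul_div_mul_left _ _ hc, one_div]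
  rfl

theorem exists_coordChange (x₀ x₁ : M) (j l : Fin (k + 1)) :
    ∃ f : DualProj EM k E → ℂ →L[ℂ] ℂ,
      ContMDiffOn 𝓘(ℂ, EM × (Fin k → ℂ)) 𝓘(ℂ, ℂ →L[ℂ] ℂ) ω f
        ((chart EM E x₀ j).source ∩ (chart EM E x₁ l).source) ∧
      ∀ p ∈ (chart EM E x₀ j).source ∩ (chart EM E x₁ l).source, ∀ c : ℂ,
        f p c = (pretriv x₁ l ⟨p, (pretriv x₀ j).symm p c⟩).2 := by
  refine ⟨fun p => (hcoord x₀ p j / hcoord x₁ p l) • ContinuousLinearMap.id ℂ ℂ,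
    (contMDiffOn_ratio x₀ x₁ j l).smul contMDiffOn_const, fun p hp c => ?_⟩
  rw [pretriv_symm_apply hp.1]
  change _ = evalAt (unitVec x₁ l p) (c • coordForm x₀ j p)
  rw [map_smul, evalAt_unitVec_coordForm]
  simp [mul_comm]

variable (EM k E) in
/-- The holomorphic structure of `𝒪(1)`. -/
def O1.prebundle : VectorPrebundle ℂ ℂ (O1 EM k E) where
  pretrivializationAtlas := {e | ∃ x₀ j, e = pretriv x₀ j}
  pretrivialization_linear' := by
    rintro _ ⟨x₀, j, rfl⟩
    infer_instance
  pretrivializationAt p := pretriv p.1 (indexAt p)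
  mem_base_pretrivializationAt := mem_chartAt_source
  pretrivialization_mem_atlas p := ⟨_, _, rfl⟩
  exists_coordChange := by
    rintro _ ⟨x₀, j, rfl⟩ _ ⟨x₁, l, rfl⟩
    obtain ⟨f, hf, h⟩ := exists_coordChange (EM := EM) (E := E) x₀ x₁ j l
    exact ⟨f, hf.continuousOn, h⟩
  totalSpaceMk_isInducing p :=
    (Topology.isInducing_const_prod (f := evalAt (unitVec p.1 (indexAt p) p)) (x := p)).2 ⟨rfl⟩

instance : (O1.prebundle EM k E).IsContMDiff 𝓘(ℂ, EM × (Fin k → ℂ)) ω where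
  exists_contMDiffCoordChange := by
    rintro _ ⟨x₀, j, rfl⟩ _ ⟨x₁, l, rfl⟩
    exact exists_coordChange x₀ x₁ j l

instance : TopologicalSpace (TotalSpace ℂ (O1 EM k E)) :=
  (O1.prebundle EM k E).totalSpaceTopology

instance : FiberBundle ℂ (O1 EM k E) := (O1.prebundle EM k E).toFiberBundle

instance : VectorBundle ℂ ℂ (O1 EM k E) := (O1.prebundle EM k E).toVectorBundle

/-- `𝒪(1)` is a holomorphic line bundle. -/
instance : ContMDiffVectorBundle ω ℂ (O1 EM k E) 𝓘(ℂ, EM × (Fin k → ℂ)) :=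
  (O1.prebundle EM k E).contMDiffVectorBundle 𝓘(ℂ, EM × (Fin k → ℂ))

end LineBundle
end DualProj

/-- A holomorphic vector bundle `E` of rank `k + 1` over a compact complex manifold is nef if the
line bundle `𝒪(1)` over `ℙ(E^*)` is nef. -/
def IsNefVectorBundle (EM : Type*) [NormedAddCommGroup EM] [NormedSpace ℂ EM] (k : ℕ)
    {M : Type*} [TopologicalSpace M] [ChartedSpace EM M] [IsManifold 𝓘(ℂ, EM) ω M]
    (E : M → Type*) [∀ x, AddCommGroup (E x)] [∀ x, Module ℂ (E x)]
    [TopologicalSpace (TotalSpace (Fin (k + 1) → ℂ) E)] [∀ x, TopologicalSpace (E x)]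
    [FiberBundle (Fin (k + 1) → ℂ) E] [VectorBundle ℂ (Fin (k + 1) → ℂ) E]
    [ContMDiffVectorBundle ω (Fin (k + 1) → ℂ) E 𝓘(ℂ, EM)] : Prop :=
  IsNefLineBundle (EM × (Fin k → ℂ)) (DualProj.O1 EM k E)

end

/-! A Hermitian metric `H` on `E` induces the dual metric on `E^*`, hence a metric on the
tautological line subbundle over `ℙ(E^*)`, hence one on its dual `𝒪(1)`: this is `O1.metric`. In the
chart where `W_j = 1`, the local frame of `𝒪(1)` has squared norm `1 / N` with `N = W* h⁻¹ W`, where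
`h` is the Gram matrix of `H` and `W` is affine in the fibre coordinates. The curvature of `𝒪(1)` is
therefore `∂∂̄ log N` (`lineCurvature_metric`).

Put `K = h⁻¹`, let `R` be the Chern curvature matrix of `h` in the direction `u`, and set `b = K W`.
Let `x = ∂W + h (∂K) W` be the covariant derivative of `W`. Completing the square gives `∂N = W* K
x` and `∂∂̄N = b* R b + x* K x` (`matWirtinger_matWirtingerBar_quadratic`), so that `∂∂̄ log N = (b*
R b) / N + (N · x* K x - |W* K x|²) / N²`. The second summand is of Fubini-Study type and is
nonnegative by the Cauchy-Schwarz inequality for `K` (`le_wirtinger_wirtingerBar_log`). In the first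
one, `b* R b = Θ_H(u ⊗ v, u ⊗ v)` and `N = ‖v‖²_H`, where `v` has coordinates `b̄` and represents
the covector `W` through `H`. Griffiths nefness thus bounds the curvature of `𝒪(1)` below by `-ε`
times the pullback of `G` to `ℙ(E^*)` (`le_lineCurvature_metric`).

This pullback is only semidefinite, but an upper bound for it is all that is needed: `ℙ(E^*)` is
compact, so it is at most `C g` for any given metric `g` (`exists_normSq_le`). The hypothesis is
then applied with `ε / C`. -/

noncomputable section

/-! ### Calculus of Wirtinger derivatives -/

section Wirtinger

variable {Q : Type*} [NormedAddCommGroup Q] [NormedSpace ℂ Q] {u z : Q} {f g : Q → ℂ}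

theorem wirtinger_congr (h : f =ᶠ[𝓝 z] g) : wirtinger u f z = wirtinger u g z := by
  simp only [wirtinger, h.fderiv_eq]

theorem wirtingerBar_congr (h : f =ᶠ[𝓝 z] g) : wirtingerBar u f z = wirtingerBar u g z := by
  simp only [wirtingerBar, h.fderiv_eq]

theorem wirtinger_const (c : ℂ) : wirtinger u (fun _ => c) z = 0 := by
  simp [wirtinger]

theorem wirtingerBar_const (c : ℂ) : wirtingerBar u (fun _ => c) z = 0 := by
  simp [wirtingerBar]

theorem wirtinger_neg : wirtinger u (fun q => -f q) z = -wirtinger u f z := by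
  simp only [wirtinger, fderiv_fun_neg, neg_apply]
  ring

theorem wirtinger_add (hf : DifferentiableAt ℝ f z) (hg : DifferentiableAt ℝ g z) :
    wirtinger u (fun q => f q + g q) z = wirtinger u f z + wirtinger u g z := by
  simp only [wirtinger, fderiv_fun_add hf hg, add_apply]
  ring

theorem wirtinger_mul (hf : DifferentiableAt ℝ f z) (hg : DifferentiableAt ℝ g z) :
    wirtinger u (fun q => f q * g q) z = wirtinger u f z * g z + f z * wirtinger u g z := by
  simp only [wirtinger, fderiv_fun_mul hf hg, add_apply,
    smul_apply, smul_eq_mul]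
  ring

theorem wirtingerBar_mul (hf : DifferentiableAt ℝ f z) (hg : DifferentiableAt ℝ g z) :
    wirtingerBar u (fun q => f q * g q) z =
      wirtingerBar u f z * g z + f z * wirtingerBar u g z := by
  simp only [wirtingerBar, fderiv_fun_mul hf hg, add_apply,
    smul_apply, smul_eq_mul]
  ring

theorem wirtinger_sum {ι : Type*} (s : Finset ι) {F : ι → Q → ℂ}
    (hF : ∀ i ∈ s, DifferentiableAt ℝ (F i) z) :
    wirtinger u (fun q => ∑ i ∈ s, F i q) z = ∑ i ∈ s, wirtinger u (F i) z := by
  simp only [wirtinger, fderiv_fun_sum hF, sum_apply, Finset.mul_sum,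
    ← Finset.sum_sub_distrib]

theorem wirtingerBar_sum {ι : Type*} (s : Finset ι) {F : ι → Q → ℂ}
    (hF : ∀ i ∈ s, DifferentiableAt ℝ (F i) z) :
    wirtingerBar u (fun q => ∑ i ∈ s, F i q) z = ∑ i ∈ s, wirtingerBar u (F i) z := by
  simp only [wirtingerBar, fderiv_fun_sum hF, sum_apply, Finset.mul_sum,
    ← Finset.sum_add_distrib]

theorem wirtingerBar_conj (hf : DifferentiableAt ℝ f z) :
    wirtingerBar u (fun q => conj (f q)) z = conj (wirtinger u f z) := by
  have h : fderiv ℝ (fun q => conj (f q)) z = Complex.conjCLE.toContinuousLinearMap.comp (fderiv ℝ f z) :=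
    (Complex.conjCLE.hasFDerivAt.comp z hf.hasFDerivAt).fderiv
  simp only [wirtingerBar, wirtinger, h, ContinuousLinearMap.comp_apply, map_mul, map_sub,
    Complex.conj_I, map_div₀, map_one, map_ofNat]
  simp [sub_eq_add_neg]

theorem wirtinger_conj (hf : DifferentiableAt ℝ f z) :
    wirtinger u (fun q => conj (f q)) z = conj (wirtingerBar u f z) := by
  have h : fderiv ℝ (fun q => conj (f q)) z = Complex.conjCLE.toContinuousLinearMap.comp (fderiv ℝ f z) :=
    (Complex.conjCLE.hasFDerivAt.comp z hf.hasFDerivAt).fderiv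
  simp only [wirtingerBar, wirtinger, h, ContinuousLinearMap.comp_apply, map_mul, map_add,
    Complex.conj_I, map_div₀, map_one, map_ofNat]
  simp [sub_eq_add_neg]

/-- Cauchy-Riemann: for a complex linear derivative, `f' (I • u) = I * f' u`, so the two halves of
the definition add up here and cancel for `wirtingerBar`. -/
theorem wirtinger_of_hasFDerivAt {f' : Q →L[ℂ] ℂ} (hf : HasFDerivAt f f' z) :
    wirtinger u f z = f' u := by
  simp only [wirtinger, (hf.restrictScalars ℝ).fderiv, ContinuousLinearMap.coe_restrictScalars',
    map_smul, smul_eq_mul, ← mul_assoc, Complex.I_mul_I]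
  ring

theorem wirtingerBar_of_hasFDerivAt {f' : Q →L[ℂ] ℂ} (hf : HasFDerivAt f f' z) :
    wirtingerBar u f z = 0 := by
  simp only [wirtingerBar, (hf.restrictScalars ℝ).fderiv, ContinuousLinearMap.coe_restrictScalars',
    map_smul, smul_eq_mul, ← mul_assoc, Complex.I_mul_I]
  ring

theorem wirtingerBar_ofReal_log {f : Q → ℝ} (hf : DifferentiableAt ℝ f z) (h0 : f z ≠ 0) :
    wirtingerBar u (fun q => (Real.log (f q) : ℂ)) z =
      wirtingerBar u (fun q => (f q : ℂ)) z / f z := by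
  have h1 := (Complex.ofRealCLM.hasFDerivAt.comp z (hf.hasFDerivAt.log h0)).fderiv
  have h2 := (Complex.ofRealCLM.hasFDerivAt.comp z hf.hasFDerivAt).fderiv
  simp only [Function.comp_def, Complex.ofRealCLM_apply] at h1 h2
  simp only [wirtingerBar, h1, h2, ContinuousLinearMap.comp_apply, smul_apply,
    Complex.ofRealCLM_apply, smul_eq_mul, Complex.ofReal_mul, Complex.ofReal_inv]
  ring

variable {P : Type*} [NormedAddCommGroup P] [NormedSpace ℂ P]

theorem wirtinger_comp_clm (L : Q →L[ℂ] P) {f : P → ℂ} (hf : DifferentiableAt ℝ f (L z)) :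
    wirtinger u (fun q => f (L q)) z = wirtinger (L u) f (L z) := by
  have h := (hf.hasFDerivAt.comp z (L.hasFDerivAt.restrictScalars ℝ)).fderiv
  simp only [Function.comp_def] at h
  simp [wirtinger, h]

theorem wirtingerBar_comp_clm (L : Q →L[ℂ] P) {f : P → ℂ} (hf : DifferentiableAt ℝ f (L z)) :
    wirtingerBar u (fun q => f (L q)) z = wirtingerBar (L u) f (L z) := by
  have h := (hf.hasFDerivAt.comp z (L.hasFDerivAt.restrictScalars ℝ)).fderiv
  simp only [Function.comp_def] at h
  simp [wirtingerBar, h]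

theorem ContDiffAt.differentiableAt_wirtingerBar (hf : ContDiffAt ℝ 2 f z) :
    DifferentiableAt ℝ (wirtingerBar u f) z := by
  have h : DifferentiableAt ℝ (fderiv ℝ f) z :=
    (hf.fderiv_right (m := 1) (by norm_num)).differentiableAt (by norm_num)
  unfold wirtingerBar
  fun_prop

/-! ### Wirtinger derivatives of matrix valued functions -/

variable {l m n : Type*}

/-- The entrywise derivative of a matrix valued function along a `(1,0)`-vector. -/
def matWirtinger (u : Q) (A : Q → Matrix m n ℂ) (z : Q) : Matrix m n ℂ :=
  Matrix.of fun i j => wirtinger u (fun q => A q i j) z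

/-- The entrywise derivative of a matrix valued function along a `(0,1)`-vector. -/
def matWirtingerBar (u : Q) (A : Q → Matrix m n ℂ) (z : Q) : Matrix m n ℂ :=
  Matrix.of fun i j => wirtingerBar u (fun q => A q i j) z

theorem matWirtinger_congr {A B : Q → Matrix m n ℂ} (h : A =ᶠ[𝓝 z] B) :
    matWirtinger u A z = matWirtinger u B z := by
  ext i j
  exact wirtinger_congr (h.mono fun q hq => congrFun (congrFun hq i) j)

theorem matWirtingerBar_congr {A B : Q → Matrix m n ℂ} (h : A =ᶠ[𝓝 z] B) :
    matWirtingerBar u A z = matWirtingerBar u B z := by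
  ext i j
  exact wirtingerBar_congr (h.mono fun q hq => congrFun (congrFun hq i) j)

theorem matWirtinger_const (A : Matrix m n ℂ) : matWirtinger u (fun _ => A) z = 0 := by
  ext i j
  exact wirtinger_const _

theorem matWirtingerBar_const (A : Matrix m n ℂ) : matWirtingerBar u (fun _ => A) z = 0 := by
  ext i j
  exact wirtingerBar_const _

theorem matWirtinger_neg {A : Q → Matrix m n ℂ} :
    matWirtinger u (fun q => -A q) z = -matWirtinger u A z := by
  ext i j
  exact wirtinger_neg

theorem matWirtinger_add {A B : Q → Matrix m n ℂ}
    (hA : ∀ i j, DifferentiableAt ℝ (fun q => A q i j) z)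
    (hB : ∀ i j, DifferentiableAt ℝ (fun q => B q i j) z) :
    matWirtinger u (fun q => A q + B q) z = matWirtinger u A z + matWirtinger u B z := by
  ext i j
  exact wirtinger_add (hA i j) (hB i j)

variable [Fintype m]

theorem differentiableAt_matMul {A : Q → Matrix l m ℂ} {B : Q → Matrix m n ℂ}
    (hA : ∀ i j, DifferentiableAt ℝ (fun q => A q i j) z)
    (hB : ∀ i j, DifferentiableAt ℝ (fun q => B q i j) z) (i : l) (j : n) :
    DifferentiableAt ℝ (fun q => (A q * B q) i j) z := by
  simp only [Matrix.mul_apply]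
  exact DifferentiableAt.fun_sum fun k _ => (hA i k).mul (hB k j)

theorem matWirtinger_mul {A : Q → Matrix l m ℂ} {B : Q → Matrix m n ℂ}
    (hA : ∀ i j, DifferentiableAt ℝ (fun q => A q i j) z)
    (hB : ∀ i j, DifferentiableAt ℝ (fun q => B q i j) z) :
    matWirtinger u (fun q => A q * B q) z =
      matWirtinger u A z * B z + A z * matWirtinger u B z := by
  ext i j
  simp only [matWirtinger, Matrix.mul_apply, Matrix.of_apply, Matrix.add_apply]
  rw [wirtinger_sum _ fun k _ => (hA i k).fun_mul (hB k j), ← Finset.sum_add_distrib]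
  exact Finset.sum_congr rfl fun k _ => wirtinger_mul (hA i k) (hB k j)

theorem matWirtingerBar_mul {A : Q → Matrix l m ℂ} {B : Q → Matrix m n ℂ}
    (hA : ∀ i j, DifferentiableAt ℝ (fun q => A q i j) z)
    (hB : ∀ i j, DifferentiableAt ℝ (fun q => B q i j) z) :
    matWirtingerBar u (fun q => A q * B q) z =
      matWirtingerBar u A z * B z + A z * matWirtingerBar u B z := by
  ext i j
  simp only [matWirtingerBar, Matrix.mul_apply, Matrix.of_apply, Matrix.add_apply]
  rw [wirtingerBar_sum _ fun k _ => (hA i k).fun_mul (hB k j), ← Finset.sum_add_distrib]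
  exact Finset.sum_congr rfl fun k _ => wirtingerBar_mul (hA i k) (hB k j)

theorem matWirtingerBar_conjTranspose {A : Q → Matrix l m ℂ}
    (hA : ∀ i j, DifferentiableAt ℝ (fun q => A q i j) z) :
    matWirtingerBar u (fun q => (A q).conjTranspose) z = (matWirtinger u A z).conjTranspose := by
  ext i j
  exact wirtingerBar_conj (hA j i)

theorem matWirtinger_conjTranspose {A : Q → Matrix l m ℂ}
    (hA : ∀ i j, DifferentiableAt ℝ (fun q => A q i j) z) :
    matWirtinger u (fun q => (A q).conjTranspose) z = (matWirtingerBar u A z).conjTranspose := by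
  ext i j
  exact wirtinger_conj (hA j i)

/-- Cramer's rule: every entry of the inverse is a polynomial in the entries divided by the
determinant. Working entrywise avoids choosing a norm on matrices. -/
theorem contDiffAt_matInv [DecidableEq m] {r : WithTop ℕ∞} {A : Q → Matrix m m ℂ}
    (hA : ∀ i j, ContDiffAt ℝ r (fun q => A q i j) z) (h0 : (A z).det ≠ 0) (i j : m) :
    ContDiffAt ℝ r (fun q => (A q)⁻¹ i j) z := by
  have hdet : ∀ {B : Q → Matrix m m ℂ}, (∀ i j, ContDiffAt ℝ r (fun q => B q i j) z) →
      ContDiffAt ℝ r (fun q => (B q).det) z := fun hB => by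
    simp only [Matrix.det_apply']
    exact ContDiffAt.sum fun σ _ => contDiffAt_const.mul (contDiffAt_prod fun k _ => hB _ _)
  simp only [Matrix.inv_def, Ring.inverse_eq_inv', Matrix.smul_apply, smul_eq_mul,
    Matrix.adjugate_apply]
  refine ((hdet hA).inv h0).mul (hdet fun a b => ?_)
  simp only [Matrix.updateRow_apply]
  split_ifs
  · exact contDiffAt_const
  · exact hA a b

end Wirtinger

/-! ### Local Chern curvature and `∂∂̄ log` of the dual norm -/

section LocalCurvature

variable {Q : Type*} [NormedAddCommGroup Q] [NormedSpace ℂ Q] {u z : Q}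
  {n m : Type*} [Fintype n] [DecidableEq n]

/-- The matrix `∑ R_{jk̄} uʲ ūᵏ` of the Chern curvature of a matrix valued function `h`. -/
def chernMatrix (u : Q) (h : Q → Matrix n n ℂ) (z : Q) : Matrix n n ℂ :=
  -matWirtinger u (matWirtingerBar u h) z +
    matWirtinger u h z * (h z)⁻¹ * matWirtingerBar u h z

theorem differentiableAt_matWirtingerBar {h : Q → Matrix n m ℂ}
    (hh : ∀ i j, ContDiffAt ℝ 2 (fun q => h q i j) z) (i : n) (j : m) :
    DifferentiableAt ℝ (fun q => matWirtingerBar u h q i j) z :=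
  (hh i j).differentiableAt_wirtingerBar

theorem eventually_differentiableAt {h : Q → Matrix n m ℂ} [Finite m]
    (hh : ∀ i j, ContDiffAt ℝ 2 (fun q => h q i j) z) :
    ∀ᶠ q in 𝓝 z, ∀ i j, DifferentiableAt ℝ (fun q => h q i j) q := by
  rw [Filter.eventually_all]
  intro i
  rw [Filter.eventually_all]
  intro j
  exact ((hh i j).eventually (by norm_num)).mono fun q hq => hq.differentiableAt (by norm_num)

/-- Differentiate `h h⁻¹ = 1`, which holds near `z`, and multiply by `h⁻¹` on the left. -/
theorem matWirtinger_inv {h : Q → Matrix n n ℂ}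
    (hh : ∀ i j, ContDiffAt ℝ 1 (fun q => h q i j) z) (hu : ∀ᶠ q in 𝓝 z, IsUnit (h q).det) :
    matWirtinger u (fun q => (h q)⁻¹) z = -((h z)⁻¹ * matWirtinger u h z * (h z)⁻¹) := by
  have hz := hu.self_of_nhds
  have h1 : matWirtinger u (fun q => h q * (h q)⁻¹) z = 0 := by
    rw [matWirtinger_congr (hu.mono fun q hq => (h q).mul_nonsing_inv hq), matWirtinger_const]
  rw [matWirtinger_mul (fun i j => (hh i j).differentiableAt (by norm_num)) fun i j =>
    (contDiffAt_matInv hh hz.ne_zero i j).differentiableAt (by norm_num)] at h1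
  have h2 := congrArg ((h z)⁻¹ * ·) h1
  simp only [mul_add, mul_zero, Matrix.nonsing_inv_mul_cancel_left _ _ hz] at h2
  rw [eq_neg_iff_add_eq_zero, add_comm, ← h2, Matrix.mul_assoc]

theorem matWirtingerBar_inv {h : Q → Matrix n n ℂ}
    (hh : ∀ i j, ContDiffAt ℝ 1 (fun q => h q i j) z) (hu : ∀ᶠ q in 𝓝 z, IsUnit (h q).det) :
    matWirtingerBar u (fun q => (h q)⁻¹) z = -((h z)⁻¹ * matWirtingerBar u h z * (h z)⁻¹) := by
  have hz := hu.self_of_nhds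
  have h1 : matWirtingerBar u (fun q => h q * (h q)⁻¹) z = 0 := by
    rw [matWirtingerBar_congr (hu.mono fun q hq => (h q).mul_nonsing_inv hq),
      matWirtingerBar_const]
  rw [matWirtingerBar_mul (fun i j => (hh i j).differentiableAt (by norm_num)) fun i j =>
    (contDiffAt_matInv hh hz.ne_zero i j).differentiableAt (by norm_num)] at h1
  have h2 := congrArg ((h z)⁻¹ * ·) h1
  simp only [mul_add, mul_zero, Matrix.nonsing_inv_mul_cancel_left _ _ hz] at h2
  rw [eq_neg_iff_add_eq_zero, add_comm, ← h2, Matrix.mul_assoc]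

/-- Differentiating `∂̄K = -K (∂̄h) K` gives three terms. Those with `∂∂̄h` and with `∂h` to the
left of `∂̄h` form `K R K`; the one in the opposite order is `(∂̄K) h (∂K)`. The latter is what
completes the square in the next computation. -/
theorem matWirtinger_matWirtingerBar_inv {h : Q → Matrix n n ℂ}
    (hh : ∀ i j, ContDiffAt ℝ 2 (fun q => h q i j) z) (hu : ∀ᶠ q in 𝓝 z, IsUnit (h q).det) :
    matWirtinger u (matWirtingerBar u fun q => (h q)⁻¹) z =
      (h z)⁻¹ * chernMatrix u h z * (h z)⁻¹ +
        matWirtingerBar u (fun q => (h q)⁻¹) z * h z * matWirtinger u (fun q => (h q)⁻¹) z := by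
  have hz := hu.self_of_nhds
  have hh1 : ∀ i j, ContDiffAt ℝ 1 (fun q => h q i j) z := fun i j =>
    (hh i j).of_le (by norm_num)
  have hev : ∀ᶠ q in 𝓝 z, ∀ i j, ContDiffAt ℝ 1 (fun q => h q i j) q := by
    rw [Filter.eventually_all]
    intro i
    rw [Filter.eventually_all]
    intro j
    exact (hh1 i j).eventually (by norm_num)
  have hd : ∀ i j, DifferentiableAt ℝ (fun q => (h q)⁻¹ i j) z := fun i j =>
    (contDiffAt_matInv hh1 hz.ne_zero i j).differentiableAt (by norm_num)
  have hdb := differentiableAt_matWirtingerBar (u := u) hh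
  rw [matWirtinger_congr ((hev.and hu.eventually_nhds).mono fun q hq =>
    matWirtingerBar_inv hq.1 hq.2), matWirtinger_neg,
    matWirtinger_mul (differentiableAt_matMul hd hdb) hd, matWirtinger_mul hd hdb,
    matWirtinger_inv hh1 hu, matWirtingerBar_inv hh1 hu]
  have e : ∀ X : Matrix n n ℂ, h z * ((h z)⁻¹ * X) = X := fun X =>
    Matrix.mul_nonsing_inv_cancel_left _ _ hz
  simp only [chernMatrix, Matrix.mul_assoc, Matrix.mul_add, Matrix.add_mul, Matrix.neg_mul,
    Matrix.mul_neg, neg_neg, neg_add_rev, e]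
  abel

open scoped ComplexOrder in
/-- The Cauchy-Schwarz inequality for a positive definite matrix. -/
theorem normSq_le_mul_of_posDef {K : Matrix n n ℂ} (hK : K.PosDef) (v w : n → ℂ) :
    Complex.normSq (star v ⬝ᵥ K.mulVec w) ≤
      (star v ⬝ᵥ K.mulVec v).re * (star w ⬝ᵥ K.mulVec w).re := by
  let := K.toSeminormedAddCommGroup hK.posSemidef
  let := K.toInnerProductSpace hK.posSemidef
  have hi : ∀ x y : n → ℂ, inner ℂ x y = star x ⬝ᵥ K.mulVec y := fun x y => dotProduct_comm _ _
  have h := inner_mul_inner_self_le (𝕜 := ℂ) v w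
  rw [norm_inner_symm w v, hi, hi, hi, Complex.norm_mul_self_eq_normSq] at h
  exact h

variable {W : Q → n → ℂ} {L : n → Q →L[ℂ] ℂ}

/-- The derivative `A'` of the holomorphic `A` is constant, so `∂∂̄(A* K A)` consists of `A* (∂∂̄K)
A`, `A'* K A'` and two cross terms. Since `∂̄K = (∂K)*` for Hermitian `h`, these combine into the
curvature term and the square `X* K X`, with `X` the covariant derivative of `A` for the Chern
connection of the dual metric. -/
theorem matWirtinger_matWirtingerBar_quadratic {h : Q → Matrix n n ℂ}
    (hh : ∀ i j, ContDiffAt ℝ 2 (fun q => h q i j) z) (hu : ∀ᶠ q in 𝓝 z, IsUnit (h q).det)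
    (hherm : ∀ᶠ q in 𝓝 z, (h q).IsHermitian)
    {A : Q → Matrix n m ℂ} {A' : Matrix n m ℂ} [Fintype m] (L : n → m → Q →L[ℂ] ℂ)
    (hA : ∀ q i j, HasFDerivAt (fun q => A q i j) (L i j) q) (hA' : ∀ i j, L i j u = A' i j) :
    let K := (h z)⁻¹
    let X := A' + h z * matWirtinger u (fun q => (h q)⁻¹) z * A z
    matWirtinger u (fun q => (A q).conjTranspose * (h q)⁻¹ * A q) z =
      (A z).conjTranspose * K * X ∧
    matWirtingerBar u (fun q => (A q).conjTranspose * (h q)⁻¹ * A q) z =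
      X.conjTranspose * K * A z ∧
    matWirtinger u (matWirtingerBar u fun q => (A q).conjTranspose * (h q)⁻¹ * A q) z =
      (A z).conjTranspose * K * chernMatrix u h z * K * A z + X.conjTranspose * K * X := by
  have hz := hu.self_of_nhds
  have hK : ∀ i j, ContDiffAt ℝ 2 (fun q => (h q)⁻¹ i j) z := contDiffAt_matInv hh hz.ne_zero
  have hAd : ∀ q i j, DifferentiableAt ℝ (fun q => A q i j) q := fun q i j =>
    ((hA q i j).restrictScalars ℝ).differentiableAt
  have hAd' : ∀ q i j, DifferentiableAt ℝ (fun q => (A q).conjTranspose i j) q := fun q i j =>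
    Complex.conjCLE.differentiableAt.comp q (hAd q j i)
  have hDA : ∀ q, matWirtinger u A q = A' := fun q => by
    ext i j
    rw [← hA' i j]
    exact wirtinger_of_hasFDerivAt (hA q i j)
  have hDbA : ∀ q, matWirtingerBar u A q = 0 := fun q => by
    ext i j
    exact wirtingerBar_of_hasFDerivAt (hA q i j)
  have hDA' : ∀ q, matWirtinger u (fun q => (A q).conjTranspose) q = 0 := fun q => by
    rw [matWirtinger_conjTranspose (hAd q), hDbA, Matrix.conjTranspose_zero]
  have hDbA' : ∀ q, matWirtingerBar u (fun q => (A q).conjTranspose) q = A'.conjTranspose :=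
    fun q => by rw [matWirtingerBar_conjTranspose (hAd q), hDA]
  have hKd := eventually_differentiableAt hK
  have hDK' : (matWirtinger u (fun q => (h q)⁻¹) z).conjTranspose =
      matWirtingerBar u (fun q => (h q)⁻¹) z := by
    rw [← matWirtingerBar_conjTranspose hKd.self_of_nhds]
    exact matWirtingerBar_congr (hherm.mono fun q hq => hq.inv)
  have hKz : ((h z)⁻¹).conjTranspose = (h z)⁻¹ := hherm.self_of_nhds.inv
  have hhz : (h z).conjTranspose = h z := hherm.self_of_nhds
  have hDb : ∀ q, (∀ i j, DifferentiableAt ℝ (fun q => (h q)⁻¹ i j) q) →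
      matWirtingerBar u (fun q => (A q).conjTranspose * (h q)⁻¹ * A q) q =
        A'.conjTranspose * (h q)⁻¹ * A q +
          (A q).conjTranspose * matWirtingerBar u (fun q => (h q)⁻¹) q * A q := fun q hq => by
    rw [matWirtingerBar_mul (differentiableAt_matMul (hAd' q) hq) (hAd q),
      matWirtingerBar_mul (hAd' q) hq, hDbA, hDbA', Matrix.mul_zero, add_zero, Matrix.add_mul]
  have e : ∀ Y : Matrix n m ℂ, h z * ((h z)⁻¹ * Y) = Y := fun Y =>
    Matrix.mul_nonsing_inv_cancel_left _ _ hz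
  have e' : ∀ Y : Matrix n m ℂ, (h z)⁻¹ * (h z * Y) = Y := fun Y =>
    Matrix.nonsing_inv_mul_cancel_left _ _ hz
  have hKb := differentiableAt_matWirtingerBar (u := u) hK
  refine ⟨?_, ?_, ?_⟩
  · rw [matWirtinger_mul (differentiableAt_matMul (hAd' z) hKd.self_of_nhds) (hAd z),
      matWirtinger_mul (hAd' z) hKd.self_of_nhds, hDA, hDA', Matrix.zero_mul, zero_add]
    simp only [Matrix.mul_add, Matrix.mul_assoc, e']
    exact add_comm _ _
  · rw [hDb z hKd.self_of_nhds]
    simp only [Matrix.conjTranspose_add, Matrix.conjTranspose_mul, hDK', hhz, Matrix.add_mul,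
      Matrix.mul_assoc, e]
  · have hc : ∀ i j, DifferentiableAt ℝ (fun _ : Q => A'.conjTranspose i j) z := fun i j =>
      differentiableAt_const _
    -- The formula for `∂̄` is differentiated once more, so it is needed on a neighbourhood of `z`
    -- and not only at `z`.
    rw [matWirtinger_congr (hKd.mono hDb),
      matWirtinger_add
        (differentiableAt_matMul (differentiableAt_matMul hc hKd.self_of_nhds) (hAd z))
        (differentiableAt_matMul (differentiableAt_matMul (hAd' z) hKb) (hAd z)),
      matWirtinger_mul (differentiableAt_matMul hc hKd.self_of_nhds) (hAd z),
      matWirtinger_mul hc hKd.self_of_nhds,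
      matWirtinger_mul (differentiableAt_matMul (hAd' z) hKb) (hAd z),
      matWirtinger_mul (hAd' z) hKb, hDA, hDA', matWirtinger_const,
      matWirtinger_matWirtingerBar_inv hh hu]
    simp only [Matrix.conjTranspose_add, Matrix.conjTranspose_mul, hDK', hhz, Matrix.add_mul,
      Matrix.mul_add, Matrix.mul_assoc, e, e', Matrix.zero_mul, zero_add]
    abel

theorem contDiffAt_star_dotProduct_inv_mulVec {r : WithTop ℕ∞} {h : Q → Matrix n n ℂ}
    (hh : ∀ i j, ContDiffAt ℝ r (fun q => h q i j) z) (h0 : (h z).det ≠ 0)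
    (hW : ∀ i, ContDiffAt ℝ r (fun q => W q i) z) :
    ContDiffAt ℝ r (fun q => star (W q) ⬝ᵥ (h q)⁻¹.mulVec (W q)) z := by
  have hK := contDiffAt_matInv hh h0
  exact ContDiffAt.sum fun i _ => (Complex.conjCLE.contDiff.contDiffAt.comp z (hW i)).mul
    (ContDiffAt.sum fun j _ => (hK i j).mul (hW j))

theorem conjTranspose_replicateCol_mul_mul (K : Matrix n n ℂ) (v w : n → ℂ) :
    ((Matrix.replicateCol Unit v).conjTranspose * K * Matrix.replicateCol Unit w) () () =
      star v ⬝ᵥ K.mulVec w := by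
  rw [Matrix.mul_assoc, ← Matrix.replicateCol_mulVec]
  rfl

open scoped ComplexOrder in
/-- A lower bound for `∂∂̄ log ‖W‖²`, where `W` is a section of the dual of a Hermitian bundle with
metric `h`, in terms of the curvature of the bundle. -/
theorem le_wirtinger_wirtingerBar_log {h : Q → Matrix n n ℂ}
    (hh : ∀ i j, ContDiffAt ℝ 2 (fun q => h q i j) z) (hpos : ∀ᶠ q in 𝓝 z, (h q).PosDef)
    (hW : ∀ q i, HasFDerivAt (fun q => W q i) (L i) q)
    (hW2 : ∀ i, ContDiffAt ℝ 2 (fun q => W q i) z) (hW0 : W z ≠ 0) :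
    let b := (h z)⁻¹.mulVec (W z)
    (star b ⬝ᵥ (chernMatrix u h z).mulVec b).re / (star (W z) ⬝ᵥ (h z)⁻¹.mulVec (W z)).re ≤
      (wirtinger u (wirtingerBar u fun q =>
        (Real.log (star (W q) ⬝ᵥ (h q)⁻¹.mulVec (W q)).re : ℂ)) z).re := by
  intro b
  set N : Q → ℂ := fun q => star (W q) ⬝ᵥ (h q)⁻¹.mulVec (W q)
  -- Viewing `W` as a one-column matrix makes `N` a product of matrices, so that the noncommutative
  -- product rules apply.
  set A : Q → Matrix n Unit ℂ := fun q => Matrix.replicateCol Unit (W q)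
  have hu : ∀ᶠ q in 𝓝 z, IsUnit (h q).det := hpos.mono fun q hq => hq.isUnit.map Matrix.detMonoidHom
  have hherm : ∀ᶠ q in 𝓝 z, (h q).IsHermitian := hpos.mono fun q hq => hq.isHermitian
  have hA : ∀ q i (j : Unit), HasFDerivAt (fun q => A q i j) (L i) q := fun q i j => hW q i
  obtain ⟨h1, h2, h3⟩ := matWirtinger_matWirtingerBar_quadratic (u := u) hh hu hherm
    (A := A) (A' := Matrix.replicateCol Unit fun i => L i u) (fun i _ => L i) hA fun _ _ => rfl
  have hNA : N = fun q => ((A q).conjTranspose * (h q)⁻¹ * A q) () () := funext fun q =>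
    (conjTranspose_replicateCol_mul_mul _ _ _).symm
  have hKpos := hpos.self_of_nhds.inv
  have hKz : ((h z)⁻¹).conjTranspose = (h z)⁻¹ := hKpos.isHermitian
  -- The covariant derivative of `W` along `u`.
  set x : n → ℂ := (fun i => L i u) + (h z * matWirtinger u (fun q => (h q)⁻¹) z).mulVec (W z)
  have hX : Matrix.replicateCol Unit (fun i => L i u) +
      h z * matWirtinger u (fun q => (h q)⁻¹) z * A z = Matrix.replicateCol Unit x := by
    rw [Matrix.replicateCol_add, Matrix.replicateCol_mulVec]
  have h1 : wirtinger u N z = star (W z) ⬝ᵥ (h z)⁻¹.mulVec x := by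
    rw [← conjTranspose_replicateCol_mul_mul, ← hX, ← h1, hNA]
    rfl
  have h2 : wirtingerBar u N z = star x ⬝ᵥ (h z)⁻¹.mulVec (W z) := by
    rw [← conjTranspose_replicateCol_mul_mul, ← hX, ← h2, hNA]
    rfl
  have h3 : wirtinger u (wirtingerBar u N) z =
      star b ⬝ᵥ (chernMatrix u h z).mulVec b + star x ⬝ᵥ (h z)⁻¹.mulVec x := by
    have hb : (Matrix.replicateCol Unit b) = (h z)⁻¹ * A z := Matrix.replicateCol_mulVec _ _
    rw [← conjTranspose_replicateCol_mul_mul, ← conjTranspose_replicateCol_mul_mul, ← hX, hb,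
      Matrix.conjTranspose_mul, hKz, ← Matrix.mul_assoc, ← Matrix.add_apply, ← h3, hNA]
    rfl
  have hNre : ∀ᶠ q in 𝓝 z, N q = ((N q).re : ℂ) := hpos.mono fun q hq =>
    (Complex.conj_eq_iff_re.1 (Complex.conj_eq_iff_im.2
      (hq.inv.posSemidef.dotProduct_mulVec_nonneg (W q)).2.symm)).symm
  have hNpos : 0 < (N z).re := hKpos.re_dotProduct_pos hW0
  have hN2 : ContDiffAt ℝ 2 N z :=
    contDiffAt_star_dotProduct_inv_mulVec hh hu.self_of_nhds.ne_zero hW2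
  have hNne : ∀ᶠ q in 𝓝 z, (N q).re ≠ 0 :=
    (Complex.continuous_re.continuousAt.comp hN2.continuousAt).eventually_ne hNpos.ne'
  have hNd : ∀ᶠ q in 𝓝 z, DifferentiableAt ℝ N q :=
    (hN2.eventually (by norm_num)).mono fun q hq => hq.differentiableAt (by norm_num)
  have hNd' : ∀ {q}, DifferentiableAt ℝ N q → DifferentiableAt ℝ (fun q => (N q).re) q :=
    fun hq => Complex.reCLM.differentiableAt.comp _ hq
  have hlog : ∀ᶠ q in 𝓝 z, wirtingerBar u (fun q => (Real.log (N q).re : ℂ)) q =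
      wirtingerBar u N q * (N q)⁻¹ := by
    filter_upwards [hNne, hNd, hNre.eventually_nhds] with q h1 h2 h3
    rw [wirtingerBar_ofReal_log (hNd' h2) h1, ← wirtingerBar_congr h3, ← h3.self_of_nhds,
      div_eq_mul_inv]
  have hz0 : N z ≠ 0 := fun h0 => hNpos.ne' (by rw [h0]; rfl)
  have hinv : wirtinger u (fun q => (N q)⁻¹) z = -wirtinger u N z / N z ^ 2 := by
    -- The derivative of `N⁻¹` is read off from `N N⁻¹ = 1` near `z`.
    have hm : wirtinger u (fun q => N q * (N q)⁻¹) z = 0 := by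
      rw [wirtinger_congr (g := fun _ => 1), wirtinger_const]
      exact (hNne.mono fun q hq => mul_inv_cancel₀ fun h0 => hq (by rw [h0]; rfl))
    rw [wirtinger_mul hNd.self_of_nhds (hNd.self_of_nhds.fun_inv hz0)] at hm
    field_simp at hm ⊢
    linear_combination hm
  -- Since `K` is Hermitian, `∂̄N` is the conjugate of `∂N`, and their product in `∂∂̄ log N`
  -- becomes a squared modulus.
  have hconj : star x ⬝ᵥ (h z)⁻¹.mulVec (W z) = conj (star (W z) ⬝ᵥ (h z)⁻¹.mulVec x) := by
    rw [Matrix.star_dotProduct, Matrix.star_mulVec, hKz, ← Matrix.dotProduct_mulVec]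
    rfl
  have hcs := normSq_le_mul_of_posDef hKpos (W z) x
  rw [wirtinger_congr hlog, wirtinger_mul hN2.differentiableAt_wirtingerBar
    (hNd.self_of_nhds.fun_inv hz0), hinv, h1, h2, h3, hconj]
  change _ / (N z).re ≤ _
  change _ ≤ (N z).re * _ at hcs
  -- The curvature term is separated from the Cauchy-Schwarz defect of `W` and `x`, which `hcs`
  -- shows to be nonnegative.
  have hfin : ((star b ⬝ᵥ (chernMatrix u h z).mulVec b + star x ⬝ᵥ (h z)⁻¹.mulVec x) * (N z)⁻¹ +
      conj (star (W z) ⬝ᵥ (h z)⁻¹.mulVec x) *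
        (-(star (W z) ⬝ᵥ (h z)⁻¹.mulVec x) / N z ^ 2)).re =
      (star b ⬝ᵥ (chernMatrix u h z).mulVec b).re / (N z).re +
        ((N z).re * (star x ⬝ᵥ (h z)⁻¹.mulVec x).re -
          Complex.normSq (star (W z) ⬝ᵥ (h z)⁻¹.mulVec x)) / (N z).re ^ 2 := by
    generalize star (W z) ⬝ᵥ (h z)⁻¹.mulVec x = c
    rw [hNre.self_of_nhds, mul_div_assoc', mul_neg, ← Complex.normSq_eq_conj_mul_self,
      ← Complex.ofReal_inv, ← Complex.ofReal_neg, ← Complex.ofReal_pow, ← Complex.ofReal_div,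
      Complex.add_re, Complex.re_mul_ofReal, Complex.ofReal_re, Complex.ofReal_re, Complex.add_re]
    field_simp
    ring
  rw [hfin]
  exact le_add_of_nonneg_right (div_nonneg (sub_nonneg.2 hcs) (sq_nonneg _))

end LocalCurvature

theorem wirtingerBar_neg {Q : Type*} [NormedAddCommGroup Q] [NormedSpace ℂ Q] {u z : Q}
    {f : Q → ℂ} : wirtingerBar u (fun q => -f q) z = -wirtingerBar u f z := by
  simp only [wirtingerBar, fderiv_fun_neg, neg_apply]
  ring

/-- A holomorphic map is smooth as a map of real manifolds. -/
theorem ContMDiffOn.real_of_complex {E F : Type*} [NormedAddCommGroup E] [NormedSpace ℂ E]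
    [NormedAddCommGroup F] [NormedSpace ℂ F] {M N : Type*} [TopologicalSpace M] [ChartedSpace E M]
    [TopologicalSpace N] [ChartedSpace F N] {f : M → N} {s : Set M}
    (hf : ContMDiffOn 𝓘(ℂ, E) 𝓘(ℂ, F) ω f s) : ContMDiffOn 𝓘(ℝ, E) 𝓘(ℝ, F) ∞ f s := fun x hx =>
  ⟨(hf x hx).1, ((hf x hx).2.restrict_scalars ℝ).of_le le_top⟩

/-! ### Gram matrices, the dual norm and its expression in charts -/

namespace DualProj

section FrameGram

variable {EM : Type*} [NormedAddCommGroup EM] [NormedSpace ℂ EM]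
  {k : ℕ} {M : Type*} [TopologicalSpace M] [ChartedSpace EM M]
  {E : M → Type*} [∀ x, AddCommGroup (E x)] [∀ x, Module ℂ (E x)]
  [TopologicalSpace (TotalSpace (Fin (k + 1) → ℂ) E)] [∀ x, TopologicalSpace (E x)]
  [FiberBundle (Fin (k + 1) → ℂ) E] [VectorBundle ℂ (Fin (k + 1) → ℂ) E]
  (H : SmoothHermitianMetric EM (Fin (k + 1) → ℂ) E)

/-- The Gram matrix of a Hermitian metric in the frame at `x₀`. -/
def frameGram (x₀ x : M) : Matrix (Fin (k + 1)) (Fin (k + 1)) ℂ :=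
  Matrix.of fun α β => H.form x (frame k E x₀ α x) (frame k E x₀ β x)

theorem gram_eq_frameGram (x₀ : M) (z : EM) :
    H.gram x₀ z = frameGram H x₀ ((chartAt EM x₀).symm z) := rfl

/-- The form is linear in its first variable, whereas `star c ⬝ᵥ h.mulVec c` is conjugate linear in
its first; hence the conjugated coordinates. The same conjugation reappears in the choice of the
vector fed to the Griffiths inequality. -/
theorem form_sum_smul_frame (x₀ x : M) (c : Fin (k + 1) → ℂ) :
    H.form x (∑ α, conj (c α) • frame k E x₀ α x) (∑ β, conj (c β) • frame k E x₀ β x) =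
      star c ⬝ᵥ (frameGram H x₀ x).mulVec c := by
  simp only [dotProduct, Matrix.mulVec, frameGram, Finset.mul_sum, map_sum, map_smulₛₗ,
    LinearMap.sum_apply, LinearMap.smul_apply, smul_eq_mul, Matrix.of_apply, Complex.conj_conj,
    RingHom.id_apply, Pi.star_apply, RCLike.star_def]
  rw [Finset.sum_comm]
  exact Finset.sum_congr rfl fun i _ => Finset.sum_congr rfl fun j _ => by ring

variable (k) in
theorem symm_eq_sum_smul_frame {x₀ x : M}
    (hx : x ∈ (trivializationAt (Fin (k + 1) → ℂ) E x₀).baseSet) (c : Fin (k + 1) → ℂ) :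
    (trivializationAt (Fin (k + 1) → ℂ) E x₀).symm x c = ∑ α, c α • frame k E x₀ α x := by
  conv_lhs => rw [← Trivialization.coe_symmₗ (R := ℂ) _ hx, pi_eq_sum_univ' c, map_sum]
  refine Finset.sum_congr rfl fun m _ => ?_
  rw [map_smul, Trivialization.coe_symmₗ _ hx]
  rfl

theorem sum_smul_frame_eq_zero {x₀ x : M}
    (hx : x ∈ (trivializationAt (Fin (k + 1) → ℂ) E x₀).baseSet) {c : Fin (k + 1) → ℂ}
    (h : ∑ α, c α • frame k E x₀ α x = 0) : c = 0 := by
  have h1 := congrArg ((trivializationAt (Fin (k + 1) → ℂ) E x₀).linearMapAt ℂ x) h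
  rw [map_sum, map_zero] at h1
  simp only [map_smul, linearMapAt_frame hx] at h1
  rw [pi_eq_sum_univ' c]
  exact h1

open scoped ComplexOrder in
theorem posDef_frameGram {x₀ x : M}
    (hx : x ∈ (trivializationAt (Fin (k + 1) → ℂ) E x₀).baseSet) : (frameGram H x₀ x).PosDef := by
  refine Matrix.PosDef.of_dotProduct_mulVec_pos ?_ fun c hc => ?_
  · ext α β
    exact H.conj_form x _ _
  · rw [← form_sum_smul_frame]
    have hne : ∑ α, conj (c α) • frame k E x₀ α x ≠ 0 := fun h => hc <| by
      have := sum_smul_frame_eq_zero hx (c := fun α => conj (c α)) h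
      funext α
      simpa using congrFun this α
    refine Complex.pos_iff.2 ⟨H.form_pos x _ hne, ?_⟩
    exact (Complex.conj_eq_iff_im.1 (H.conj_form x _ _)).symm

open scoped ComplexOrder in
theorem isUnit_det_frameGram {x₀ x : M}
    (hx : x ∈ (trivializationAt (Fin (k + 1) → ℂ) E x₀).baseSet) :
    IsUnit (frameGram H x₀ x).det :=
  (posDef_frameGram H hx).isUnit.map Matrix.detMonoidHom

theorem frame_eq_sum_transition {x₀ : M} (x₁ : M) {x : M}
    (hx : x ∈ (trivializationAt (Fin (k + 1) → ℂ) E x₀).baseSet) (i : Fin (k + 1)) :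
    frame k E x₁ i x = ∑ m, transition E x₀ x₁ x m i • frame k E x₀ m x :=
  (sum_smul_frame hx _).symm

/-- The conjugate of the matrix of the change of frame. -/
def conjTransition (E : M → Type*) [∀ x, AddCommGroup (E x)] [∀ x, Module ℂ (E x)]
    [TopologicalSpace (TotalSpace (Fin (k + 1) → ℂ) E)] [∀ x, TopologicalSpace (E x)]
    [FiberBundle (Fin (k + 1) → ℂ) E] [VectorBundle ℂ (Fin (k + 1) → ℂ) E] (x₀ x₁ x : M) :
    Matrix (Fin (k + 1)) (Fin (k + 1)) ℂ :=
  Matrix.of fun m i => conj (transition E x₀ x₁ x m i)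

theorem frameGram_eq {x₀ : M} (x₁ : M) {x : M}
    (hx : x ∈ (trivializationAt (Fin (k + 1) → ℂ) E x₀).baseSet) :
    frameGram H x₁ x =
      (conjTransition E x₀ x₁ x).conjTranspose * frameGram H x₀ x * conjTransition E x₀ x₁ x := by
  ext α β
  simp only [frameGram, Matrix.of_apply, Matrix.mul_apply, Matrix.conjTranspose_apply,
    conjTransition]
  rw [frame_eq_sum_transition x₁ hx α, frame_eq_sum_transition x₁ hx β]
  simp only [map_sum, map_smulₛₗ, LinearMap.sum_apply, LinearMap.smul_apply, smul_eq_mul,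
    RingHom.id_apply, Finset.mul_sum, Finset.sum_mul, RCLike.star_def, Complex.conj_conj]
  exact Finset.sum_congr rfl fun i _ => Finset.sum_congr rfl fun j _ => mul_comm _ _

theorem hcoord_eq_mulVec {x₀ : M} (x₁ : M) {p : DualProj EM k E}
    (hx : p.1 ∈ (trivializationAt (Fin (k + 1) → ℂ) E x₀).baseSet) :
    hcoord x₁ p = (conjTransition E x₀ x₁ p.1).conjTranspose.mulVec (hcoord x₀ p) := by
  funext i
  rw [hcoord_eq_sum x₁ hx]
  simp [Matrix.mulVec, dotProduct, conjTransition, mul_comm]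

/-- The squared norm of the chosen representative of a point of `ℙ(E^*)` for the dual metric,
computed in the frame at `x₀`. -/
def dualNormSq (x₀ : M) (p : DualProj EM k E) : ℂ :=
  star (hcoord x₀ p) ⬝ᵥ (frameGram H x₀ p.1)⁻¹.mulVec (hcoord x₀ p)

/-- With `B` the conjugate of the frame change, the Gram matrix becomes `B* h B` and the homogeneous
coordinates become `B* W`, so all factors `B` cancel in `W* h⁻¹ W`. -/
theorem dualNormSq_eq {x₀ x₁ : M} {p : DualProj EM k E}
    (h₀ : p.1 ∈ (trivializationAt (Fin (k + 1) → ℂ) E x₀).baseSet)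
    (h₁ : p.1 ∈ (trivializationAt (Fin (k + 1) → ℂ) E x₁).baseSet) :
    dualNormSq H x₁ p = dualNormSq H x₀ p := by
  have hu := isUnit_det_frameGram H h₁
  rw [frameGram_eq H x₁ h₀, Matrix.det_mul, Matrix.det_mul] at hu
  have hB := isUnit_of_mul_isUnit_right hu
  have hB' := isUnit_of_mul_isUnit_left (isUnit_of_mul_isUnit_left hu)
  unfold dualNormSq
  rw [frameGram_eq H x₁ h₀, hcoord_eq_mulVec x₁ h₀, Matrix.mul_inv_rev, Matrix.mul_inv_rev,
    Matrix.mulVec_mulVec, Matrix.mul_assoc, Matrix.mul_assoc, Matrix.nonsing_inv_mul _ hB',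
    Matrix.mul_one, Matrix.star_mulVec, Matrix.conjTranspose_conjTranspose,
    ← Matrix.dotProduct_mulVec, Matrix.mulVec_mulVec, ← Matrix.mul_assoc,
    Matrix.mul_nonsing_inv _ hB, Matrix.one_mul]

open scoped ComplexOrder in
theorem dualNormSq_pos (p : DualProj EM k E) : 0 < dualNormSq H p.1 p := by
  have hx := mem_baseSet_trivializationAt (Fin (k + 1) → ℂ) E p.1
  refine (posDef_frameGram H hx).inv.dotProduct_mulVec_pos fun h => ?_
  obtain ⟨i, hi⟩ := exists_hcoord_ne_zero hx
  exact hi (congrFun h i)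

/-- The squared norm for the dual metric of the covector with homogeneous coordinates
`insertOne j w` in the frame at `x₀`, as a function of the coordinates `(z, w)`. -/
def chartNormSq (x₀ : M) (j : Fin (k + 1)) (q : EM × (Fin k → ℂ)) : ℂ :=
  star (insertOne j q.2) ⬝ᵥ (H.gram x₀ q.1)⁻¹.mulVec (insertOne j q.2)

theorem hcoord_eq_smul_insertOne {x₀ : M} {j : Fin (k + 1)} {p : DualProj EM k E}
    (hp : p ∈ (chart EM E x₀ j).source) :
    hcoord x₀ p = hcoord x₀ p j • insertOne j (chart EM E x₀ j p).2 := by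
  funext i
  have hne : hcoord x₀ p j ≠ 0 := hp.2
  rcases Fin.eq_self_or_eq_succAbove j i with rfl | ⟨l, rfl⟩
  · simp [insertOne]
  · simp [insertOne, chart, mul_div_cancel₀ _ hne]

/-- The representative of a line is an arbitrary choice with no regularity in `p`. This isolates the
choice in the factor `|W_j|²`, leaving a function which is smooth in the chart. -/
theorem dualNormSq_eq_chartNormSq {x₀ : M} {j : Fin (k + 1)} {p : DualProj EM k E}
    (hp : p ∈ (chart EM E x₀ j).source) :
    dualNormSq H p.1 p =
      hcoord x₀ p j * conj (hcoord x₀ p j) * chartNormSq H x₀ j (chart EM E x₀ j p) := by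
  rw [dualNormSq_eq H hp.1.2 (mem_baseSet_trivializationAt _ E p.1)]
  have hz : H.gram x₀ (chart EM E x₀ j p).1 = frameGram H x₀ p.1 := by
    rw [gram_eq_frameGram]
    exact congrArg (frameGram H x₀) ((chartAt EM x₀).left_inv hp.1.1)
  rw [dualNormSq, chartNormSq, hz, hcoord_eq_smul_insertOne hp]
  simp only [star_smul, Matrix.mulVec_smul, smul_dotProduct, dotProduct_smul, smul_eq_mul,
    Pi.smul_apply, RCLike.star_def]
  have : insertOne j (chart EM E x₀ j p).2 j = 1 := by simp [insertOne]
  rw [this]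
  set c := star (insertOne j (chart EM E x₀ j p).2) ⬝ᵥ
    (frameGram H x₀ p.1)⁻¹.mulVec (insertOne j (chart EM E x₀ j p).2)
  rw [mul_one, mul_assoc]

open scoped ComplexOrder in
theorem chartNormSq_pos {x₀ : M} {j : Fin (k + 1)} {q : EM × (Fin k → ℂ)}
    (hq : q ∈ (chart EM E x₀ j).target) : 0 < chartNormSq H x₀ j q :=
  (posDef_frameGram H hq.2.2).inv.dotProduct_mulVec_pos (insertOne_ne_zero j q.2)

theorem contDiffAt_gram [IsManifold 𝓘(ℂ, EM) ω M] {x₀ : M} {z : EM}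
    (hz : z ∈ (chartAt EM x₀).target)
    (hz' : (chartAt EM x₀).symm z ∈ (trivializationAt (Fin (k + 1) → ℂ) E x₀).baseSet)
    (α β : Fin (k + 1)) : ContDiffAt ℝ ∞ (fun z => H.gram x₀ z α β) z := by
  have h := (H.smooth x₀ (Pi.single α 1) (Pi.single β 1)).comp
    (((contMDiffOn_chart_symm (I := 𝓘(ℂ, EM)) (n := ω) (x := x₀)).real_of_complex).mono
      inter_subset_left) (fun z hz => hz.2 : (chartAt EM x₀).target ∩ (chartAt EM x₀).symm ⁻¹'
        (trivializationAt (Fin (k + 1) → ℂ) E x₀).baseSet ⊆ _)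
  rw [contMDiffOn_iff_contDiffOn] at h
  exact h.contDiffAt (((chartAt EM x₀).isOpen_inter_preimage_symm
    (trivializationAt (Fin (k + 1) → ℂ) E x₀).open_baseSet).mem_nhds ⟨hz, hz'⟩)

/-- The normalized homogeneous coordinates are affine in `(z, w)`, so one `L` serves at every point,
as `le_wirtinger_wirtingerBar_log` requires. -/
theorem hasFDerivAt_insertOne (j : Fin (k + 1)) (i : Fin (k + 1)) :
    ∃ L : EM × (Fin k → ℂ) →L[ℂ] ℂ, ∀ q, HasFDerivAt (fun q => insertOne j q.2 i) L q := by
  rcases Fin.eq_self_or_eq_succAbove j i with rfl | ⟨l, rfl⟩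
  · refine ⟨0, fun q => ?_⟩
    simpa [insertOne] using hasFDerivAt_const (1 : ℂ) q
  · refine ⟨(ContinuousLinearMap.proj l).comp (ContinuousLinearMap.snd ℂ EM (Fin k → ℂ)), fun q => ?_⟩
    simp only [insertOne, Fin.insertNth_apply_succAbove]
    exact ((ContinuousLinearMap.proj l).comp
      (ContinuousLinearMap.snd ℂ EM (Fin k → ℂ))).hasFDerivAt

theorem contDiff_insertOne (j : Fin (k + 1)) (i : Fin (k + 1)) :
    ContDiff ℂ ω fun q : EM × (Fin k → ℂ) => insertOne j q.2 i := by
  rcases Fin.eq_self_or_eq_succAbove j i with rfl | ⟨l, rfl⟩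
  · simpa [insertOne] using contDiff_const
  · simp only [insertOne, Fin.insertNth_apply_succAbove]
    fun_prop

theorem contDiffAt_insertOne (j : Fin (k + 1)) (i : Fin (k + 1)) (q : EM × (Fin k → ℂ)) :
    ContDiffAt ℝ ∞ (fun q : EM × (Fin k → ℂ) => insertOne j q.2 i) q :=
  ((contDiff_insertOne j i).contDiffAt.restrict_scalars ℝ).of_le le_top

theorem contDiffAt_gram_fst [IsManifold 𝓘(ℂ, EM) ω M] {x₀ : M} {j : Fin (k + 1)}
    {q : EM × (Fin k → ℂ)} (hq : q ∈ (chart EM E x₀ j).target) (α β : Fin (k + 1)) :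
    ContDiffAt ℝ ∞ (fun q : EM × (Fin k → ℂ) => H.gram x₀ q.1 α β) q := by
  have hfst : ContDiffAt ℝ ∞ (Prod.fst : EM × (Fin k → ℂ) → EM) q :=
    ((contDiff_fst (𝕜 := ℂ)).contDiffAt.restrict_scalars ℝ).of_le le_top
  exact (contDiffAt_gram H hq.1 hq.2.2 α β).comp q hfst

theorem contDiffAt_chartNormSq [IsManifold 𝓘(ℂ, EM) ω M] {x₀ : M} {j : Fin (k + 1)}
    {q : EM × (Fin k → ℂ)} (hq : q ∈ (chart EM E x₀ j).target) :
    ContDiffAt ℝ ∞ (chartNormSq H x₀ j) q :=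
  contDiffAt_star_dotProduct_inv_mulVec (contDiffAt_gram_fst H hq)
    (isUnit_det_frameGram H hq.2.2).ne_zero fun i => contDiffAt_insertOne j i q

end FrameGram

/-! ### The induced Hermitian metric on `𝒪(1)` -/

section Metric

variable {EM : Type*} [NormedAddCommGroup EM] [NormedSpace ℂ EM]
  {k : ℕ} {M : Type*} [TopologicalSpace M] [ChartedSpace EM M]
  {E : M → Type*} [∀ x, AddCommGroup (E x)] [∀ x, Module ℂ (E x)]
  [TopologicalSpace (TotalSpace (Fin (k + 1) → ℂ) E)] [∀ x, TopologicalSpace (E x)]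
  [FiberBundle (Fin (k + 1) → ℂ) E] [VectorBundle ℂ (Fin (k + 1) → ℂ) E]
  [ContMDiffVectorBundle ω (Fin (k + 1) → ℂ) E 𝓘(ℂ, EM)] [IsManifold 𝓘(ℂ, EM) ω M]
  (H : SmoothHermitianMetric EM (Fin (k + 1) → ℂ) E)

variable (EM E) in
theorem trivializationAt_O1_symm {p₀ p : DualProj EM k E}
    (hp : p ∈ (chart EM E p₀.1 (indexAt p₀)).source) (c : ℂ) :
    (trivializationAt ℂ (O1 EM k E) p₀).symm p c = c • coordForm p₀.1 (indexAt p₀) p :=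
  pretriv_symm_apply hp c

/-- The Hermitian form on the fibres of `𝒪(1)` induced by a Hermitian metric on `E`. -/
def O1.form (p : DualProj EM k E) : O1 EM k E p →ₗ[ℂ] O1 EM k E p →ₗ⋆[ℂ] ℂ :=
  LinearMap.mk₂'ₛₗ (RingHom.id ℂ) (starRingEnd ℂ)
    (fun s t => evalAt (generator p) s * conj (evalAt (generator p) t) / dualNormSq H p.1 p)
    (fun s s' t => by rw [map_add]; ring) (fun c s t => by
      rw [map_smul]; simp only [smul_eq_mul, RingHom.id_apply]; ring)
    (fun s t t' => by rw [map_add, map_add]; ring) (fun c s t => by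
      rw [map_smul]; simp only [smul_eq_mul, map_mul]; ring)

theorem O1.form_apply (p : DualProj EM k E) (s t : O1 EM k E p) :
    O1.form H p s t =
      evalAt (generator p) s * conj (evalAt (generator p) t) / dualNormSq H p.1 p := rfl

-- The factor `|W_j|²` coming from the generator occurs in both numerator and denominator and
-- cancels. What remains depends only on the chart coordinates, which is why the metric is smooth.
open scoped ComplexOrder in
theorem O1.form_smul_coordForm {x₀ : M} {j : Fin (k + 1)} {p : DualProj EM k E}
    (hp : p ∈ (chart EM E x₀ j).source) (a b : ℂ) :
    O1.form H p (a • coordForm x₀ j p) (b • coordForm x₀ j p) =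
      a * conj b * (chartNormSq H x₀ j (chart EM E x₀ j p))⁻¹ := by
  have hne : hcoord x₀ p j ≠ 0 := hp.2
  have hne' : conj (hcoord x₀ p j) ≠ 0 := (map_ne_zero _).2 hne
  have hN : chartNormSq H x₀ j (chart EM E x₀ j p) ≠ 0 :=
    (chartNormSq_pos H ((chart EM E x₀ j).map_source hp)).ne'
  have hg : evalAt (generator p) (coordForm x₀ j p) = hcoord x₀ p j := rfl
  rw [O1.form_apply, dualNormSq_eq_chartNormSq H hp, map_smul, map_smul, hg]
  simp only [smul_eq_mul, map_mul]
  field_simp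

open scoped ComplexOrder in
theorem O1.conj_form (p : DualProj EM k E) (s t : O1 EM k E p) :
    conj (O1.form H p s t) = O1.form H p t s := by
  have h : conj (dualNormSq H p.1 p) = dualNormSq H p.1 p :=
    Complex.conj_eq_iff_im.2 (dualNormSq_pos H p).2.symm
  simp only [O1.form_apply, map_div₀, map_mul, h, Complex.conj_conj]
  ring

theorem eq_zero_of_evalAt_generator {p : DualProj EM k E} {s : O1 EM k E p}
    (h : evalAt (generator p) s = 0) : s = 0 := by
  have h1 := evalAt_smul_coordForm (hcoord_indexAt p) s
  have h2 : evalAt (unitVec p.1 (indexAt p) p) s =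
      (hcoord p.1 p (indexAt p))⁻¹ * evalAt (generator p) s :=
    map_smul (show Module.Dual ℂ p.2.submodule from s) _ _
  rw [← h1, h2, h, mul_zero, zero_smul]

open scoped ComplexOrder in
theorem O1.form_pos (p : DualProj EM k E) (s : O1 EM k E p) (hs : s ≠ 0) :
    0 < (O1.form H p s s).re := by
  have hN := dualNormSq_pos H p
  have hN' : dualNormSq H p.1 p = ((dualNormSq H p.1 p).re : ℂ) :=
    (Complex.conj_eq_iff_re.1 (Complex.conj_eq_iff_im.2 hN.2.symm)).symm
  rw [O1.form_apply, Complex.mul_conj, hN', ← Complex.ofReal_div, Complex.ofReal_re]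
  exact div_pos (Complex.normSq_pos.2 fun h => hs (eq_zero_of_evalAt_generator h)) hN.1

open scoped ComplexOrder in
theorem contMDiffOn_inv_chartNormSq (x₀ : M) (j : Fin (k + 1)) (c : ℂ) :
    ContMDiffOn 𝓘(ℝ, EM × (Fin k → ℂ)) 𝓘(ℝ, ℂ) ∞
      (fun p : DualProj EM k E => c * (chartNormSq H x₀ j (chart EM E x₀ j p))⁻¹)
      (chart EM E x₀ j).source := by
  have h : ContMDiffOn 𝓘(ℝ, EM × (Fin k → ℂ)) 𝓘(ℝ, ℂ) ∞
      (fun q => c * (chartNormSq H x₀ j q)⁻¹) (chart EM E x₀ j).target :=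
    contMDiffOn_iff_contDiffOn.2 fun q hq => (contDiffAt_const.mul
      ((contDiffAt_chartNormSq H hq).inv (chartNormSq_pos H hq).ne')).contDiffWithinAt
  exact h.comp (contMDiffOn_chart x₀ j).real_of_complex (chart EM E x₀ j).mapsTo

/-- The Hermitian metric on `𝒪(1)` induced by a Hermitian metric on `E`. -/
def O1.metric : SmoothHermitianMetric (EM × (Fin k → ℂ)) ℂ (O1 EM k E) where
  form := O1.form H
  conj_form := O1.conj_form H
  form_pos := O1.form_pos H
  smooth p₀ v w := by
    refine (contMDiffOn_inv_chartNormSq H p₀.1 (indexAt p₀) (v * conj w)).congr fun p hp => ?_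
    rw [trivializationAt_O1_symm EM E hp, trivializationAt_O1_symm EM E hp,
      O1.form_smul_coordForm H hp]

end Metric
end DualProj

/-! ### Curvature of `𝒪(1)` bounded below by the curvature of `E` -/

namespace DualProj

section Curvature

variable {EM : Type*} [NormedAddCommGroup EM] [NormedSpace ℂ EM]
  {k : ℕ} {M : Type*} [TopologicalSpace M] [ChartedSpace EM M]
  {E : M → Type*} [∀ x, AddCommGroup (E x)] [∀ x, Module ℂ (E x)]
  [TopologicalSpace (TotalSpace (Fin (k + 1) → ℂ) E)] [∀ x, TopologicalSpace (E x)]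
  [FiberBundle (Fin (k + 1) → ℂ) E] [VectorBundle ℂ (Fin (k + 1) → ℂ) E]
  [ContMDiffVectorBundle ω (Fin (k + 1) → ℂ) E 𝓘(ℂ, EM)] [IsManifold 𝓘(ℂ, EM) ω M]
  (H : SmoothHermitianMetric EM (Fin (k + 1) → ℂ) E)

/-- The projection to the base coordinates is complex linear, so Wirtinger derivatives of a pulled
back function along `u` are those of the function along `u.1`. -/
theorem chernMatrix_comp_fst {x₀ : M} {j : Fin (k + 1)}
    {q : EM × (Fin k → ℂ)} (hq : q ∈ (chart EM E x₀ j).target) (u : EM × (Fin k → ℂ)) :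
    chernMatrix u (fun q : EM × (Fin k → ℂ) => H.gram x₀ q.1) q =
      chernMatrix u.1 (H.gram x₀) q.1 := by
  have hle : ((2 : ℕ∞) : WithTop ℕ∞) ≤ ∞ := by exact_mod_cast le_top
  have hc := contDiffAt_gram H hq.1 hq.2.2
  have hd : ∀ᶠ q' in 𝓝 q, ∀ i j, DifferentiableAt ℝ (fun z => H.gram x₀ z i j) q'.1 :=
    continuousAt_fst.eventually (eventually_differentiableAt
      (h := H.gram x₀) fun i j => (hc i j).of_le hle)
  have h1 : matWirtinger u (fun q : EM × (Fin k → ℂ) => H.gram x₀ q.1) q =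
      matWirtinger u.1 (H.gram x₀) q.1 := by
    ext α β
    exact wirtinger_comp_clm (ContinuousLinearMap.fst ℂ EM (Fin k → ℂ)) (hd.self_of_nhds α β)
  have h2 : ∀ᶠ q' in 𝓝 q, matWirtingerBar u (fun q : EM × (Fin k → ℂ) => H.gram x₀ q.1) q' =
      matWirtingerBar u.1 (H.gram x₀) q'.1 := hd.mono fun q' hq' => by
    ext α β
    exact wirtingerBar_comp_clm (ContinuousLinearMap.fst ℂ EM (Fin k → ℂ)) (hq' α β)
  have h3 : matWirtinger u (matWirtingerBar u fun q : EM × (Fin k → ℂ) => H.gram x₀ q.1) q =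
      matWirtinger u.1 (matWirtingerBar u.1 (H.gram x₀)) q.1 := by
    rw [matWirtinger_congr h2]
    ext α β
    exact wirtinger_comp_clm (ContinuousLinearMap.fst ℂ EM (Fin k → ℂ))
      (f := fun z => matWirtingerBar u.1 (H.gram x₀) z α β)
      (differentiableAt_matWirtingerBar (fun i j => (hc i j).of_le hle) α β)
  rw [chernMatrix, h1, h2.self_of_nhds, h3, chernMatrix]

theorem isOpen_chart_target (x₀ : M) (j : Fin (k + 1)) : IsOpen (chart EM E x₀ j).target :=
  ((chartAt EM x₀).isOpen_inter_preimage_symm ((chartAt EM x₀).open_source.inter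
    (trivializationAt (Fin (k + 1) → ℂ) E x₀).open_baseSet)).preimage continuous_fst

-- The preferred chart and the preferred trivialization at `p` belong to the same pair `(p.1,
-- indexAt p)`. There the frame has squared norm `1 / N`, and the sign of the logarithm cancels the
-- sign in the definition of the curvature.
open scoped ComplexOrder in
theorem lineCurvature_metric (p : DualProj EM k E) (u : EM × (Fin k → ℂ)) :
    (O1.metric H).lineCurvature p u =
      (wirtinger u (wirtingerBar u fun q =>
        (Real.log (chartNormSq H p.1 (indexAt p) q).re : ℂ)) (chart EM E p.1 (indexAt p) p)).re := by
  have hp := (chart EM E p.1 (indexAt p)).map_source (mem_chartAt_source p)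
  have hev : ∀ᶠ q in 𝓝 (chart EM E p.1 (indexAt p) p),
      (Real.log ((O1.metric H).normSq ((chart EM E p.1 (indexAt p)).symm q)
        ((trivializationAt ℂ (O1 EM k E) p).symm ((chart EM E p.1 (indexAt p)).symm q) 1)) : ℂ) =
      -(Real.log (chartNormSq H p.1 (indexAt p) q).re : ℂ) := by
    filter_upwards [(isOpen_chart_target p.1 (indexAt p)).mem_nhds hp] with q hq
    have hs := (chart EM E p.1 (indexAt p)).map_target hq
    have hN := chartNormSq_pos H hq
    have hN' : chartNormSq H p.1 (indexAt p) q = ((chartNormSq H p.1 (indexAt p) q).re : ℂ) :=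
      (Complex.conj_eq_iff_re.1 (Complex.conj_eq_iff_im.2 hN.2.symm)).symm
    rw [trivializationAt_O1_symm EM E hs]
    change (Real.log (O1.form H _ _ _).re : ℂ) = _
    rw [O1.form_smul_coordForm H hs, (chart EM E p.1 (indexAt p)).right_inv hq, hN']
    simp [← Complex.ofReal_inv, Real.log_inv]
  refine (congrArg (fun c : ℂ => (-c).re)
    (wirtinger_congr (hev.eventually_nhds.mono fun q hq => wirtingerBar_congr (u := u) hq))).trans ?_
  simp only [wirtingerBar_neg, wirtinger_neg, neg_neg]

open scoped ComplexOrder in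
theorem le_lineCurvature_metric {G : HermitianMetricOn EM M} {ε : ℝ}
    (hH : ∀ (x : M) (u : TangentSpace 𝓘(ℂ, EM) x) (v : E x),
      -ε * G.normSq x u * H.normSq x v ≤ H.griffithsCurvature x u v)
    (p : DualProj EM k E) (u : EM × (Fin k → ℂ)) :
    -ε * G.normSq p.1 u.1 ≤ (O1.metric H).lineCurvature p u := by
  set j := indexAt p
  set q := chart EM E p.1 j p
  have hq : q ∈ (chart EM E p.1 j).target := (chart EM E p.1 j).map_source (mem_chartAt_source p)
  have hx := mem_baseSet_trivializationAt (Fin (k + 1) → ℂ) E p.1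
  have hN := chartNormSq_pos H hq
  choose L hL using hasFDerivAt_insertOne (EM := EM) j
  have hle : ((2 : ℕ∞) : WithTop ℕ∞) ≤ ∞ := by exact_mod_cast le_top
  have key := le_wirtinger_wirtingerBar_log (u := u) (z := q)
    (h := fun q : EM × (Fin k → ℂ) => H.gram p.1 q.1) (W := fun q => insertOne j q.2) (L := L)
    (fun α β => (contDiffAt_gram_fst H hq α β).of_le hle)
    (by filter_upwards [(isOpen_chart_target p.1 j).mem_nhds hq] with q' hq'
        exact posDef_frameGram H hq'.2.2)
    (fun q i => hL i q) (fun i => (contDiffAt_insertOne j i q).of_le hle)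
    (insertOne_ne_zero j q.2)
  rw [lineCurvature_metric]
  refine le_trans ?_ key
  rw [chernMatrix_comp_fst H hq]
  set h := H.gram p.1 q.1
  have hgram : h = frameGram H p.1 p.1 :=
    congrArg (frameGram H p.1) ((chartAt EM p.1).left_inv (mem_chart_source EM p.1))
  have hu : IsUnit h.det := hgram ▸ isUnit_det_frameGram H hx
  set b := h⁻¹.mulVec (insertOne j q.2) with hb
  refine (le_div_iff₀ hN.1).2 ?_
  -- The vector `v` with coordinates `b̄`, where `b = h⁻¹ W`, satisfies `H(·, v) = W`. Its squared
  -- norm is `b* h b = W* h⁻¹ W = N`, exactly the denominator.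
  have h1 := hH p.1 u.1 ((trivializationAt (Fin (k + 1) → ℂ) E p.1).symm p.1 (star b))
  have h2 : H.normSq p.1 ((trivializationAt (Fin (k + 1) → ℂ) E p.1).symm p.1 (star b)) =
      (chartNormSq H p.1 j q).re := by
    rw [symm_eq_sum_smul_frame k hx]
    refine congrArg Complex.re ((form_sum_smul_frame H p.1 p.1 b).trans ?_)
    have hherm : h⁻¹.conjTranspose = h⁻¹ := by
      rw [hgram]
      exact (posDef_frameGram H hx).inv.isHermitian
    rw [← hgram, hb, Matrix.mulVec_mulVec, Matrix.mul_nonsing_inv _ hu, Matrix.one_mulVec,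
      Matrix.star_mulVec, hherm, ← Matrix.dotProduct_mulVec]
    rfl
  have h3 : H.griffithsCurvature p.1 u.1
      ((trivializationAt (Fin (k + 1) → ℂ) E p.1).symm p.1 (star b)) =
      (star b ⬝ᵥ (chernMatrix u.1 (H.gram p.1) q.1).mulVec b).re := by
    have hc : (trivializationAt (Fin (k + 1) → ℂ) E p.1
        ⟨p.1, (trivializationAt (Fin (k + 1) → ℂ) E p.1).symm p.1 (star b)⟩).2 = star b := by
      rw [Trivialization.apply_mk_symm _ hx]
    -- `curvatureMatrix` is by definition `chernMatrix` of the Gram matrix at `chartAt EM p.1 p.1`,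
    -- which is `q.1`.
    change (∑ α, ∑ β, chernMatrix u.1 (H.gram p.1) q.1 α β *
      (trivializationAt (Fin (k + 1) → ℂ) E p.1
        ⟨p.1, (trivializationAt (Fin (k + 1) → ℂ) E p.1).symm p.1 (star b)⟩).2 α *
      conj ((trivializationAt (Fin (k + 1) → ℂ) E p.1
        ⟨p.1, (trivializationAt (Fin (k + 1) → ℂ) E p.1).symm p.1 (star b)⟩).2 β)).re = _
    rw [hc]
    simp only [dotProduct, Matrix.mulVec, Finset.mul_sum, Pi.star_apply, RCLike.star_def,
      Complex.conj_conj]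
    exact congrArg Complex.re (Finset.sum_congr rfl fun i _ => Finset.sum_congr rfl fun j _ => by ring)
  rw [h2, h3] at h1
  exact h1

end Curvature
end DualProj

/-! ### Compactness of `ℙ(E^*)` -/

namespace DualProj

section Compact

variable {EM : Type*} [NormedAddCommGroup EM] [NormedSpace ℂ EM]
  {k : ℕ} {M : Type*} [TopologicalSpace M] [ChartedSpace EM M]
  {E : M → Type*} [∀ x, AddCommGroup (E x)] [∀ x, Module ℂ (E x)]
  [TopologicalSpace (TotalSpace (Fin (k + 1) → ℂ) E)] [∀ x, TopologicalSpace (E x)]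
  [FiberBundle (Fin (k + 1) → ℂ) E] [VectorBundle ℂ (Fin (k + 1) → ℂ) E]
  [ContMDiffVectorBundle ω (Fin (k + 1) → ℂ) E 𝓘(ℂ, EM)] [IsManifold 𝓘(ℂ, EM) ω M]

theorem continuousOn_chart_symm (x₀ : M) (j : Fin (k + 1)) :
    ContinuousOn (chart EM E x₀ j).symm (chart EM E x₀ j).target :=
  ((core EM k E).openPartialHomeomorph (chart EM E x₀ j) ⟨x₀, j, rfl⟩).continuousOn_symm

/-- Dividing by a homogeneous coordinate of maximal modulus puts the affine coordinates in the
closed unit polydisc, the unit ball of the sup norm. Hence the lines over a small compact piece of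
the base are covered by `k + 1` continuous images of compact sets, one for each `j`. -/
theorem exists_mem_nhds_isCompact_preimage [FiniteDimensional ℂ EM] (x₀ : M) :
    ∃ U ∈ 𝓝 x₀, ∃ K : Set (DualProj EM k E), IsCompact K ∧ ∀ p : DualProj EM k E, p.1 ∈ U → p ∈ K := by
  have := FiniteDimensional.proper ℂ EM
  have hO := (chartAt EM x₀).isOpen_inter_preimage_symm ((chartAt EM x₀).open_source.inter
    (trivializationAt (Fin (k + 1) → ℂ) E x₀).open_baseSet)
  have hx : chartAt EM x₀ x₀ ∈ (chartAt EM x₀).target ∩ (chartAt EM x₀).symm ⁻¹'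
      ((chartAt EM x₀).source ∩ (trivializationAt (Fin (k + 1) → ℂ) E x₀).baseSet) := by
    refine ⟨mem_chart_target EM x₀, ?_⟩
    rw [mem_preimage, (chartAt EM x₀).left_inv (mem_chart_source EM x₀)]
    exact ⟨mem_chart_source EM x₀, mem_baseSet_trivializationAt _ E x₀⟩
  obtain ⟨C, hC, hCx, hCO⟩ := exists_compact_subset hO hx
  let D : Set (Fin k → ℂ) := Metric.closedBall 0 1
  refine ⟨(chartAt EM x₀).source ∩ chartAt EM x₀ ⁻¹' interior C, ?_,
    ⋃ j, (chart EM E x₀ j).symm '' (C ×ˢ D), ?_, fun p hp => ?_⟩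
  · exact ((chartAt EM x₀).isOpen_inter_preimage isOpen_interior).mem_nhds
      ⟨mem_chart_source EM x₀, hCx⟩
  · refine isCompact_iUnion fun j => (hC.prod (isCompact_closedBall 0 1)).image_of_continuousOn
      ((continuousOn_chart_symm x₀ j).mono fun q hq => ?_)
    exact hCO hq.1
  · have hb : p.1 ∈ chartBase EM k E x₀ := by
      have h := (hCO (interior_subset hp.2)).2
      rwa [mem_preimage, (chartAt EM x₀).left_inv hp.1] at h
    obtain ⟨j, hj⟩ := Finite.exists_max fun i => ‖hcoord x₀ p i‖
    have hne : hcoord x₀ p j ≠ 0 := fun h0 => by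
      obtain ⟨i, hi⟩ := exists_hcoord_ne_zero hb.2
      have := hj i
      rw [h0, norm_zero] at this
      exact hi (norm_le_zero_iff.1 this)
    refine mem_iUnion.2 ⟨j, chart EM E x₀ j p, ⟨interior_subset hp.2, ?_⟩,
      (chart EM E x₀ j).left_inv ⟨hb, hne⟩⟩
    rw [mem_closedBall_zero_iff, pi_norm_le_iff_of_nonneg zero_le_one]
    intro i
    change ‖hcoord x₀ p (j.succAbove i) / hcoord x₀ p j‖ ≤ 1
    rw [norm_div]
    exact div_le_one_of_le₀ (hj _) (norm_nonneg _)

/-- The projectivized dual bundle over a compact manifold is compact. -/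
instance [FiniteDimensional ℂ EM] [CompactSpace M] : CompactSpace (DualProj EM k E) := by
  choose U hU K hK hUK using exists_mem_nhds_isCompact_preimage (EM := EM) (k := k) (E := E)
  obtain ⟨t, -, ht⟩ := isCompact_univ.elim_nhds_subcover U fun x _ => hU x
  refine ⟨(t.isCompact_biUnion fun x _ => hK x).of_isClosed_subset isClosed_univ fun p _ => ?_⟩
  obtain ⟨x, hx, hp⟩ := mem_iUnion₂.1 (ht (mem_univ p.1))
  exact mem_iUnion₂.2 ⟨x, hx, hUK x p hp⟩

end Compact
end DualProj

/-! ### Homogeneity and continuity of the squared norm -/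

namespace SmoothHermitianMetric

variable {EB : Type*} [NormedAddCommGroup EB] [NormedSpace ℂ EB]
  {F : Type*} [NormedAddCommGroup F] [NormedSpace ℂ F]
  {B : Type*} [TopologicalSpace B] [ChartedSpace EB B]
  {V : B → Type*} [∀ x, AddCommGroup (V x)] [∀ x, Module ℂ (V x)]
  [TopologicalSpace (TotalSpace F V)] [∀ x, TopologicalSpace (V x)] [FiberBundle F V]
  (H : SmoothHermitianMetric EB F V)

theorem normSq_pos {x : B} {v : V x} (hv : v ≠ 0) : 0 < H.normSq x v := H.form_pos x v hv

theorem normSq_nonneg (x : B) (v : V x) : 0 ≤ H.normSq x v := by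
  rcases eq_or_ne v 0 with rfl | hv
  · simp [normSq]
  · exact (H.normSq_pos hv).le

theorem normSq_smul (x : B) (c : ℂ) (v : V x) :
    H.normSq x (c • v) = Complex.normSq c * H.normSq x v := by
  simp only [normSq, map_smul, map_smulₛₗ, LinearMap.smul_apply, smul_eq_mul, ← mul_assoc,
    Complex.normSq_eq_conj_mul_self.symm, Complex.re_ofReal_mul]

/-- Smoothness is only assumed for fixed model vectors. Expanding in a basis of the
finite-dimensional fibre turns the squared norm into a finite sum of continuous coefficients times
coordinates, which gives joint continuity in point and vector. -/
theorem continuousAt_normSq_symm [VectorBundle ℂ F V] [FiniteDimensional ℂ F] (x₀ : B) {x : B}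
    (hx : x ∈ (trivializationAt F V x₀).baseSet) (v : F) :
    ContinuousAt (fun y : B × F => H.normSq y.1 ((trivializationAt F V x₀).symm y.1 y.2))
      (x, v) := by
  let b := Module.finBasis ℂ F
  have hcoord : ∀ i, Continuous fun v : F => b.repr v i := fun i =>
    (LinearMap.continuous_of_finiteDimensional (b.coord i))
  have hform : ∀ i j, ContinuousAt (fun y : B × F => H.form y.1
      ((trivializationAt F V x₀).symm y.1 (b i)) ((trivializationAt F V x₀).symm y.1 (b j)))
      (x, v) := fun i j => by
    have h := (H.smooth x₀ (b i) (b j)).continuousOn.continuousAt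
      ((trivializationAt F V x₀).open_baseSet.mem_nhds hx)
    exact ContinuousAt.comp (f := Prod.fst) (x := (x, v)) h continuousAt_fst
  have hsum : ContinuousAt (fun y : B × F => (∑ i, ∑ j, b.repr y.2 i * (conj (b.repr y.2 j) *
      H.form y.1 ((trivializationAt F V x₀).symm y.1 (b i))
        ((trivializationAt F V x₀).symm y.1 (b j)))).re) (x, v) := by
    refine Complex.continuous_re.continuousAt.comp
      (tendsto_finsetSum _ fun i _ => tendsto_finsetSum _ fun j _ => ?_)
    exact ((hcoord i).comp continuous_snd).continuousAt.mul
      ((Complex.continuous_conj.comp ((hcoord j).comp continuous_snd)).continuousAt.mul (hform i j))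
  refine hsum.congr ?_
  filter_upwards [((trivializationAt F V x₀).open_baseSet.preimage
    (continuous_fst (Y := F))).mem_nhds (show (x, v) ∈ _ from hx)] with y hy
  have hy' : y.1 ∈ (trivializationAt F V x₀).baseSet := hy
  have hs : (trivializationAt F V x₀).symm y.1 y.2 =
      ∑ i, b.repr y.2 i • (trivializationAt F V x₀).symm y.1 (b i) := by
    simp only [← Trivialization.coe_symmₗ (R := ℂ) _ hy', ← map_smul, ← map_sum, b.sum_repr]
  rw [hs, normSq]
  simp only [map_sum, map_smul, map_smulₛₗ, LinearMap.sum_apply, LinearMap.smul_apply,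
    smul_eq_mul]
  rw [Finset.sum_comm]
  simp only [Finset.mul_sum]
  refine congrArg Complex.re (Finset.sum_congr rfl fun i _ => Finset.sum_congr rfl fun j _ => ?_)
  exact mul_left_comm _ _ _

end SmoothHermitianMetric

/-! ### Comparison of the pullback of `G` with a metric on `ℙ(E^*)` -/

namespace DualProj

variable {EM : Type*} [NormedAddCommGroup EM] [NormedSpace ℂ EM]
  {k : ℕ} {M : Type*} [TopologicalSpace M] [ChartedSpace EM M]
  {E : M → Type*} [∀ x, AddCommGroup (E x)] [∀ x, Module ℂ (E x)]
  [TopologicalSpace (TotalSpace (Fin (k + 1) → ℂ) E)] [∀ x, TopologicalSpace (E x)]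
  [FiberBundle (Fin (k + 1) → ℂ) E] [VectorBundle ℂ (Fin (k + 1) → ℂ) E]
  [ContMDiffVectorBundle ω (Fin (k + 1) → ℂ) E 𝓘(ℂ, EM)] [IsManifold 𝓘(ℂ, EM) ω M]

/-- The tangent space at `x` is the model space read in the preferred chart at `x`, so inverting the
trivialization at `x₀` amounts to applying the derivative of a change of charts. Recording that
derivative allows comparison by uniqueness of derivatives. -/
theorem trivializationAt_tangentSpace_symm {B : Type*} {EB : Type*} [NormedAddCommGroup EB]
    [NormedSpace ℂ EB] [TopologicalSpace B] [ChartedSpace EB B] [IsManifold 𝓘(ℂ, EB) ω B]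
    {x₀ x : B} (hx : x ∈ (chartAt EB x₀).source) (u : EB) :
    HasFDerivAt (chartAt EB x ∘ (chartAt EB x₀).symm) (tangentCoordChange 𝓘(ℂ, EB) x₀ x x)
      (chartAt EB x₀ x) ∧
    (trivializationAt EB (TangentSpace 𝓘(ℂ, EB) : B → Type _) x₀).symm x u =
      tangentCoordChange 𝓘(ℂ, EB) x₀ x x u := by
  have : IsManifold 𝓘(ℂ, EB) 1 B := IsManifold.of_le (n := ω) le_top
  constructor
  · have h := hasFDerivWithinAt_tangentCoordChange (I := 𝓘(ℂ, EB)) (x := x₀) (y := x) (z := x)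
      ⟨by simpa using hx, by simp⟩
    simpa [hasFDerivWithinAt_univ] using h
  · have h := TangentBundle.symmL_trivializationAt_eq_core (I := 𝓘(ℂ, EB)) hx
    have hs : (trivializationAt EB (TangentSpace 𝓘(ℂ, EB) : B → Type _) x₀).symmL ℂ x u =
        (trivializationAt EB (TangentSpace 𝓘(ℂ, EB) : B → Type _) x₀).symm x u :=
      Trivialization.symmL_apply _ hx u
    exact hs.symm.trans (congrArg (fun L => L u) h)

/-- The first component of a change of charts on `ℙ(E^*)` is the change of charts on the base
applied to the first coordinate. Differentiating this identity shows that `u ↦ u.1`, the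
differential of the projection, commutes with the tangent trivializations. -/
theorem symm_tangentSpace_fst {p₀ p : DualProj EM k E}
    (hp : p ∈ (chartAt (EM × (Fin k → ℂ)) p₀).source) (u : EM × (Fin k → ℂ)) :
    ((trivializationAt (EM × (Fin k → ℂ)) (TangentSpace 𝓘(ℂ, EM × (Fin k → ℂ)) :
      DualProj EM k E → Type _) p₀).symm p u : EM × (Fin k → ℂ)).1 =
    (trivializationAt EM (TangentSpace 𝓘(ℂ, EM) : M → Type _) p₀.1).symm p.1 u.1 := by
  have hx : p.1 ∈ (chartAt EM p₀.1).source := hp.1.1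
  obtain ⟨h1, h2⟩ := trivializationAt_tangentSpace_symm hp u
  obtain ⟨h3, h4⟩ := trivializationAt_tangentSpace_symm hx u.1
  rw [h4, h2]
  have h5 := (ContinuousLinearMap.fst ℂ EM (Fin k → ℂ)).hasFDerivAt.comp _ h1
  have h6 := HasFDerivAt.comp (chartAt (EM × (Fin k → ℂ)) p₀ p)
    (g := chartAt EM p.1 ∘ (chartAt EM p₀.1).symm) h3
    (ContinuousLinearMap.fst ℂ EM (Fin k → ℂ)).hasFDerivAt
  exact congrArg (fun L => L u) (h5.unique h6)

theorem continuousAt_proj (p₀ : DualProj EM k E) :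
    ContinuousAt (fun p : DualProj EM k E => p.1) p₀ := by
  have hs := mem_chart_source (EM × (Fin k → ℂ)) p₀
  have h1 : ContinuousAt (fun p : DualProj EM k E =>
      (chartAt EM p₀.1).symm (chartAt (EM × (Fin k → ℂ)) p₀ p).1) p₀ :=
    ContinuousAt.comp (g := fun q : EM × (Fin k → ℂ) => (chartAt EM p₀.1).symm q.1)
      (ContinuousAt.comp (f := Prod.fst) ((chartAt EM p₀.1).continuousAt_symm
        (mem_chart_target EM p₀.1)) continuousAt_fst)
      ((chartAt (EM × (Fin k → ℂ)) p₀).continuousAt hs)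
  refine h1.congr ?_
  filter_upwards [(chartAt (EM × (Fin k → ℂ)) p₀).open_source.mem_nhds hs] with p hp
  exact (chartAt EM p₀.1).left_inv hp.1.1

theorem exists_eventually_normSq_le [FiniteDimensional ℂ EM] (G : HermitianMetricOn EM M)
    (g : HermitianMetricOn (EM × (Fin k → ℂ)) (DualProj EM k E)) (p₀ : DualProj EM k E) :
    ∃ C : ℝ, ∀ᶠ p in 𝓝 p₀, ∀ u : EM × (Fin k → ℂ),
      G.normSq p.1 u.1 ≤ C * g.normSq p u := by
  have := FiniteDimensional.proper ℂ (EM × (Fin k → ℂ))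
  -- The identification of tangent spaces with the model space through the preferred charts need not
  -- vary continuously with `p`, so both metrics are read in trivializations fixed at `p₀`.
  let e := trivializationAt (EM × (Fin k → ℂ)) (TangentSpace 𝓘(ℂ, EM × (Fin k → ℂ)) :
    DualProj EM k E → Type _) p₀
  let e' := trivializationAt EM (TangentSpace 𝓘(ℂ, EM) : M → Type _) p₀.1
  let a : DualProj EM k E × (EM × (Fin k → ℂ)) → ℝ := fun y => g.normSq y.1 (e.symm y.1 y.2)
  let b : DualProj EM k E × (EM × (Fin k → ℂ)) → ℝ := fun y =>
    G.normSq y.1.1 (e'.symm y.1.1 y.2.1)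
  have ha : ∀ u, ContinuousAt a (p₀, u) := fun u =>
    g.continuousAt_normSq_symm p₀ (mem_baseSet_trivializationAt _ _ p₀) u
  have hb : ∀ u, ContinuousAt b (p₀, u) := fun u => by
    have hf : ContinuousAt (fun y : DualProj EM k E × (EM × (Fin k → ℂ)) => (y.1.1, y.2.1))
        (p₀, u) :=
      (ContinuousAt.comp (f := Prod.fst) (x := (p₀, u)) (continuousAt_proj p₀)
        continuousAt_fst).prodMk (continuous_fst.comp continuous_snd).continuousAt
    exact ContinuousAt.comp (x := (p₀, u)) (f := fun y : DualProj EM k E × (EM × (Fin k → ℂ)) =>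
      (y.1.1, y.2.1)) (G.continuousAt_normSq_symm p₀.1 (mem_baseSet_trivializationAt _ _ p₀.1) u.1) hf
  have hpos : ∀ u, u ≠ 0 → 0 < a (p₀, u) := fun u hu => by
    refine g.normSq_pos fun h0 => hu ?_
    have hm := mem_baseSet_trivializationAt (EM × (Fin k → ℂ))
      (TangentSpace 𝓘(ℂ, EM × (Fin k → ℂ)) : DualProj EM k E → Type _) p₀
    have h := e.apply_mk_symm hm u
    rw [h0] at h
    have h' := e.linearMapAt_symmₗ (R := ℂ) hm u
    rw [Trivialization.coe_symmₗ _ hm] at h'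
    exact h'.symm.trans ((congrArg (e.linearMapAt ℂ p₀) h0).trans (map_zero _))
  have hS : IsCompact (Metric.sphere (0 : EM × (Fin k → ℂ)) 1) := isCompact_sphere 0 1
  have hne : ∀ u ∈ Metric.sphere (0 : EM × (Fin k → ℂ)) 1, u ≠ 0 := fun u hu =>
    ne_zero_of_mem_unit_sphere ⟨u, hu⟩
  obtain ⟨C, hC⟩ := hS.exists_bound_of_continuousOn (f := fun u => b (p₀, u) / a (p₀, u))
    fun u hu => (ContinuousAt.div ((hb u).comp (Continuous.prodMk_right p₀).continuousAt)
      ((ha u).comp (Continuous.prodMk_right p₀).continuousAt)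
      (hpos u (hne u hu)).ne').continuousWithinAt
  -- `C` bounds the ratio `b / a` on the unit sphere at `p₀`. Enlarging it to `C + 1` makes the
  -- inequality strict, hence open, and compactness of the sphere gives one neighbourhood for all
  -- `u`.
  have hev : ∀ᶠ p in 𝓝 p₀, ∀ u ∈ Metric.sphere (0 : EM × (Fin k → ℂ)) 1,
      b (p, u) < (C + 1) * a (p, u) := by
    refine hS.eventually_forall_of_forall_eventually fun u hu => ?_
    refine (hb u).eventually_lt (continuousAt_const.mul (ha u)) ?_
    have h1 := (le_abs_self _).trans (hC u hu)
    have h2 := hpos u (hne u hu)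
    rw [div_le_iff₀ h2] at h1
    linarith
  refine ⟨C + 1, ?_⟩
  filter_upwards [hev, (chartAt (EM × (Fin k → ℂ)) p₀).open_source.mem_nhds
    (mem_chart_source _ p₀)] with p hp hps u
  have hm : p ∈ e.baseSet := hps
  obtain ⟨v, rfl⟩ : ∃ v, e.symm p v = u :=
    ⟨e.linearMapAt ℂ p u, e.symm_linearMapAt hm u⟩
  have hb' : G.normSq p.1 (e.symm p v : EM × (Fin k → ℂ)).1 = b (p, v) :=
    congrArg (G.normSq p.1) (symm_tangentSpace_fst hps v)
  rw [hb']
  change b (p, v) ≤ (C + 1) * a (p, v)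
  have hxm : p.1 ∈ e'.baseSet := hps.1.1
  have hsmul : ∀ (c : ℂ) (w : EM × (Fin k → ℂ)),
      a (p, c • w) = Complex.normSq c * a (p, w) ∧ b (p, c • w) = Complex.normSq c * b (p, w) :=
    fun c w => by
    constructor
    · refine Eq.trans (congrArg (g.normSq p) ?_) (g.normSq_smul p c (e.symm p w))
      simp only [← Trivialization.coe_symmₗ (R := ℂ) _ hm, map_smul]
    · refine Eq.trans (congrArg (G.normSq p.1) ?_) (G.normSq_smul p.1 c (e'.symm p.1 w.1))
      simp only [← Trivialization.coe_symmₗ (R := ℂ) _ hxm, ← map_smul]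
      rfl
  rcases eq_or_ne v 0 with rfl | hv
  · have h := hsmul 0 0
    simp only [zero_smul, map_zero, zero_mul] at h
    rw [h.1, h.2, mul_zero]
  -- Both sides scale by `|c|²`, so the estimate on the unit sphere extends to all nonzero vectors.
  · have hw := (hp ((‖v‖⁻¹ : ℂ) • v) (by
      rw [mem_sphere_zero_iff_norm]
      exact_mod_cast norm_smul_inv_norm (𝕜 := ℂ) hv)).le
    rw [(hsmul _ v).1, (hsmul _ v).2, mul_left_comm] at hw
    refine le_of_mul_le_mul_left hw (Complex.normSq_pos.2 (inv_ne_zero ?_))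
    exact_mod_cast norm_ne_zero_iff.2 hv

theorem exists_normSq_le [FiniteDimensional ℂ EM] [CompactSpace M] (G : HermitianMetricOn EM M)
    (g : HermitianMetricOn (EM × (Fin k → ℂ)) (DualProj EM k E)) :
    ∃ C : ℝ, 0 < C ∧ ∀ (p : DualProj EM k E) (u : EM × (Fin k → ℂ)),
      G.normSq p.1 u.1 ≤ C * g.normSq p u := by
  obtain ⟨C, hC⟩ : ∃ C : ℝ, ∀ p ∈ (univ : Set (DualProj EM k E)), ∀ u : EM × (Fin k → ℂ),
      G.normSq p.1 u.1 ≤ C * g.normSq p u := by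
    refine isCompact_univ.induction_on ⟨0, fun p hp => hp.elim⟩
      (fun s t hst ⟨C, hC⟩ => ⟨C, fun p hp => hC p (hst hp)⟩) ?_ fun p _ => ?_
    · rintro s t ⟨C, hC⟩ ⟨C', hC'⟩
      refine ⟨max C C', fun p hp u => ?_⟩
      rcases hp with hp | hp
      · exact (hC p hp u).trans
          (mul_le_mul_of_nonneg_right (le_max_left _ _) (g.normSq_nonneg p u))
      · exact (hC' p hp u).trans
          (mul_le_mul_of_nonneg_right (le_max_right _ _) (g.normSq_nonneg p u))
    · obtain ⟨C, hC⟩ := exists_eventually_normSq_le G g p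
      exact ⟨_, mem_nhdsWithin_of_mem_nhds hC, C, fun q hq => hq⟩
  -- The maximum with `1` makes the constant positive, so that `ε` can be divided by it.
  exact ⟨max C 1, lt_max_of_lt_right one_pos, fun p u => (hC p (mem_univ p) u).trans
    (mul_le_mul_of_nonneg_right (le_max_left _ _) (g.normSq_nonneg p u))⟩

end DualProj

end

theorem mainTheorem10
    {EM : Type*} [NormedAddCommGroup EM] [NormedSpace ℂ EM] [FiniteDimensional ℂ EM]
    {M : Type*} [TopologicalSpace M] [T2Space M] [CompactSpace M]
    [ChartedSpace EM M] [IsManifold 𝓘(ℂ, EM) ω M]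
    (G : HermitianMetricOn EM M)
    (k : ℕ) (E : M → Type*) [∀ x, AddCommGroup (E x)] [∀ x, Module ℂ (E x)]
    [TopologicalSpace (TotalSpace (Fin (k + 1) → ℂ) E)] [∀ x, TopologicalSpace (E x)]
    [FiberBundle (Fin (k + 1) → ℂ) E] [VectorBundle ℂ (Fin (k + 1) → ℂ) E]
    [ContMDiffVectorBundle ω (Fin (k + 1) → ℂ) E 𝓘(ℂ, EM)]
    (hE : IsGriffithsNef G (k + 1) E) :
    IsNefVectorBundle EM k E := by
  intro g ε hε
  obtain ⟨C, hC, hG⟩ := DualProj.exists_normSq_le G g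
  -- The loss of the factor `C` in comparing the pullback of `G` with `g` is compensated in advance.
  obtain ⟨H, hH⟩ := hE (ε / C) (div_pos hε hC)
  refine ⟨DualProj.O1.metric H, fun p u => ?_⟩
  refine le_trans ?_ (DualProj.le_lineCurvature_metric H hH p u)
  have h := mul_le_mul_of_nonneg_left (hG p u) (div_pos hε hC).le
  rw [← mul_assoc, div_mul_cancel₀ _ hC.ne'] at h
  rw [neg_mul, neg_mul]
  exact neg_le_neg h
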